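/- **Setting.** Let $n,d\ge 1$ and $\mathbb N=\{1,2,\dots\}$, $\mathbb N_0=\mathbb N\cup\{0\}$. $|\cdot|$ is the Euclidean norm of vectors and the induced 2-norm of matrices, $|\cdot|_F$ the Frobenius norm, $B_r(0)$ the closed ball. Let $\mathbb X,\mathbb W\subseteq\mathbb R^n$, $\mathbb U\subseteq\mathbb R^m$, $\mathbb S\subseteq\mathbb R^q$, let $f:\mathbb X\times\mathbb U\to\mathbb R^n$, $\psi:\mathbb X\times\mathbb U\to\mathbb R^d$, $\alpha:\mathbb X\times\mathbb S\times\mathbb R^{d\times n}\to\mathbb U$, $\theta_*,\vartheta_0\in\mathbb R^{d\times n}$, $\gamma>0$, and assume that $g(x,u,w):=f(x,u)+\theta_*^\top\psi(x,u)+w\in\mathbb X$ for all $x\in\mathbb X,u\in\mathbb U,w\in\mathbb W$. On a probability space with measure $\mathbb P$, let $W(t)$ $(t\in\mathbb N)$ and $S(t)$ $(t\in\mathbb N_0)$ be random vectors with values in $\mathbb W$ and $\mathbb S$. For $x_0\in\mathbb X$ the closed loop is $X(0)=x_0$, $X(t+1)=g(X(t),U(t),W(t+1))$, $U(t)=\alpha(X(t),S(t),\hat\theta(t-1))$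 for $t\in\mathbb N_0$, where $\hat\theta(-1)=\hat\theta(0)=\vartheta_0$ and, for $t\in\mathbb N$, $\hat\theta(t)$ is the regularised least squares (RLS) estimate $$\hat\theta(t)=\arg\min_{\theta\in\mathbb R^{d\times n}}\ \sum_{s=1}^t\big|X(s)-\theta^\top\psi(X(s-1),U(s-1))-f(X(s-1),U(s-1))\big|^2+\gamma|\theta|_F^2 .$$ $\mathcal K_\infty$ is the class of continuous, strictly increasing, unbounded $\chi:\mathbb R_{\ge0}\to\mathbb R_{\ge0}$ with $\chi(0)=0$; $\chi$ is $k$-SE if $\ln\chi(r^k)=o(r)$ as $r\to\infty$. **Assumptions.** 1. $f,\psi,\alpha$ are Borel measurable. 2. $\{W(t)\}_{t\in\mathbb N}$ is i.i.d. with law $\mu_w$, $\{S(t)\}_{t\in\mathbb N_0}$ is i.i.d. with law $\mu_s$, the two sequences are independent of each other, and $W(t)$ is zero-mean and $\sigma_w^2$-sub-Gaussian ($\sigma_w\ge0$): $\mathbb E\,e^{\lambda\zeta^\top W(t)}\le e^{\lambda^2\sigma_w^2/2}$ for all $\lambda\in\mathbb R$ and unit vectors $\zeta$. 3. There are $\chi_1,\chi_3,\sigma_2\in\mathcal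 K_\infty$ that are 1-SE, $\chi_4\in\mathcal K_\infty$ that is 2-SE, $\chi_2,\sigma_1\in\mathcal K_\infty$ and $c_1\ge0$ such that for all $t\in\mathbb N_0$, $\xi\in\mathbb X$, $u(i)\in\mathbb U$, $w(i)\in\mathbb W$ the solution $\phi(t)$ of $\phi(0)=\xi$, $\phi(i+1)=g(\phi(i),u(i),w(i+1))$ satisfies $$|\phi(t)|\le\chi_1(t)+\chi_2(|\xi|)+\chi_3\Big(\sum_{i=0}^{t-1}\sigma_1(|u(i)|)\Big)+\chi_4\Big(\sum_{i=1}^{t}\sigma_2(|w(i)|)\Big)+c_1 .$$ 4. $|\alpha(x,s,\vartheta)|\le u_{\max}$ for all $x,s,\vartheta$. 5. There is a nondecreasing $\chi_5:\mathbb R_{\ge0}\to\mathbb R_{\ge0}$ with $\chi_5(r)=O(r^k)$ as $r\to\infty$ for some natural number $k$, such that $|\psi(x,u)|\le\chi_5(\sqrt{|x|^2+|u|^2})$ for all $x\in\mathbb X,u\in\mathbb U$. 6. (Regional excitation) $\mathcal X_{\rm PE}\subseteq\mathbb X$ and $c_{\rm PE},p_{\rm PE}>0$ are such that for all $\vartheta\in\mathbb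 R^{d\times n}$, $x\in\mathcal X_{\rm PE}$ and unit vectors $\zeta\in\mathbb R^d$, if $(S,W)\sim\mu_s\times\mu_w$, then with probability at least $p_{\rm PE}$ one has $x+W\in\mathbb X$ and $|\zeta^\top\psi(x+W,\alpha(x+W,S,\vartheta))|^2\ge c_{\rm PE}$. **Definitions.** $\overline w(0,\delta)=0$ and $\overline w(t,\delta)=\sigma_w\sqrt{2n\ln\frac{n\pi^2t^2}{3\delta}}$ for $t\in\mathbb N$; $\overline x(t,\delta,x_0)=\chi_1(t)+\chi_2(|x_0|)+\chi_3(t\sigma_1(u_{\max}))+\chi_4(t\sigma_2(\overline w(t,\delta)))+c_1$; $\overline z(t,\delta,x_0)=\chi_5\big(\sqrt{\overline x(t-1,\delta,x_0)^2+u_{\max}^2}\big)$; $\beta_{\max}(t,\delta,x_0)=\sum_{i=1}^t\overline z(i,\delta,x_0)^2+\gamma$; $\Gamma(\mathcal X)=\{f(x,u)+\theta_*^\top\psi(x,u): x\in\mathcal X,\ u\in\mathbb U,\ |u|\le u_{\max}\}$; $$T_{\text{excited}}(\delta,x_0)=\sup\{T\in\mathbb N:\Gamma(B_{\overline x(T-1,\delta/3,x_0)}(0)\cap\mathbb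 X)\subseteq\mathcal X_{\rm PE}\}\in\mathbb N_0\cup\{\infty\}\quad(\sup\emptyset=0);$$ $$T_{\text{burn-in}}(\delta,x_0)=\inf\Big\{T\in\mathbb N:\ t\ge\tfrac{2}{(1-\ln2)p_{\rm PE}}\Big(d\ln\Big(1+\tfrac{16\sum_{i=1}^t\overline z(i,\delta/3,x_0)^2}{c_{\rm PE}p_{\rm PE}(t-1)}\Big)+\ln\tfrac{\pi^2(t-T+1)^2}{2\delta}\Big)+1\ \ \forall t\ge T\Big\}\quad(\inf\emptyset=\infty);$$ $$e(t,\delta,x_0)=\frac{\gamma^{1/2}|\theta_*|_F+\sigma_w\sqrt{2n\big(\ln(3n/\delta)+\tfrac d2\ln(\beta_{\max}(t,\delta/3,x_0)\gamma^{-1})\big)}}{\sqrt{\tfrac{c_{\rm PE}p_{\rm PE}}4(t-1)+\gamma}} .$$ **Theorem.** Under assumptions 1–6, for every $\delta\in(0,1)$ and $x_0\in\mathbb X$, $T_{\text{burn-in}}(\delta,x_0)<\infty$; and if $T_{\text{burn-in}}(\delta,x_0)\le T_{\text{excited}}(\delta,x_0)$, then $$\mathbb P\big(|\hat\theta(t)-\theta_*|\le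 e(t,\delta,x_0)\ \text{ for all } t\in\mathbb N \text{ with } T_{\text{burn-in}}(\delta,x_0)\le t\le T_{\text{excited}}(\delta,x_0)\big)\ge1-\delta .$$ -/

import Mathlib

open MeasureTheory ProbabilityTheory Filter Topology
open scoped NNReal ENNReal RealInnerProductSpace

noncomputable section

namespace SysId

/-- The Euclidean space of column vectors of length `k`. -/
abbrev E (k : ℕ) : Type := EuclideanSpace ℝ (Fin k)

/-- Parameters: real matrices with `d` rows and `n` columns. -/
abbrev Param (d n : ℕ) : Type := Matrix (Fin d) (Fin n) ℝ

/-- Matrices carry the product σ-field of their entries, which is the Borel σ-field. -/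
instance (d n : ℕ) : MeasurableSpace (Param d n) :=
  inferInstanceAs (MeasurableSpace (Fin d → Fin n → ℝ))

instance (d n : ℕ) : BorelSpace (Param d n) :=
  inferInstanceAs (BorelSpace (Fin d → Fin n → ℝ))

/-- The Frobenius norm of a matrix. -/
def frobNorm {d n : ℕ} (A : Param d n) : ℝ := √(∑ i, ∑ j, A i j ^ 2)

/-- The induced 2-norm of a matrix: the operator norm between Euclidean spaces. -/
def specNorm {d n : ℕ} (A : Param d n) : ℝ :=
  ‖LinearMap.toContinuousLinearMap (Matrix.toEuclideanLin A)‖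

/-- The vector `θᵀ z`. -/
def trMul {d n : ℕ} (θ : Param d n) (z : E d) : E n := Matrix.toEuclideanLin θ.transpose z

/-! ### The closed-loop system -/

/-- The deterministic data of the closed loop. The system is
`x⁺ = f (x, u) + θᵀ ψ (x, u) + w`, the policy is `u = α (x, s, estimate)`, and `γ`, `ϑ₀` are the
regularisation parameter and the initial estimate. The sets `X`, `U`, `W`, `S` are those in which
states, controls, process noise and exploratory noise take their values. The field `step_mem` says
that the system map has codomain `X`. -/
structure Model (n m d q : ℕ) where
  X : Set (E n)
  U : Set (E m)
  W : Set (E n)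
  S : Set (E q)
  f : X × U → E n
  ψ : X × U → E d
  α : X × S × Param d n → U
  θ : Param d n
  γ : ℝ
  γ_pos : 0 < γ
  ϑ₀ : Param d n
  step_mem : ∀ (x : X) (u : U) (w : W), f (x, u) + trMul θ (ψ (x, u)) + (w : E n) ∈ X

namespace Model

variable {n m d q : ℕ} (M : Model n m d q)

/-- The one-step prediction `g (x, u, 0) = f (x, u) + θᵀ ψ (x, u)`. -/
def predict (x : M.X) (u : M.U) : E n := M.f (x, u) + trMul M.θ (M.ψ (x, u))

/-- The system map `g (x, u, w) = f (x, u) + θᵀ ψ (x, u) + w`. -/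
def step (x : M.X) (u : M.U) (w : M.W) : M.X :=
  ⟨M.predict x u + (w : E n), M.step_mem x u w⟩

/-- The deterministic state solution at time `t` from `ξ`, under the controls `u 0, u 1, …` and the
process noise `w 1, w 2, …` (only `u 0, …, u (t-1)` and `w 1, …, w t` matter). -/
def solution (ξ : M.X) (u : ℕ → M.U) (w : ℕ → M.W) : ℕ → M.X
  | 0 => ξ
  | t + 1 => M.step (solution ξ u w t) (u t) (w (t + 1))

/-- The regularised least squares cost of the data up to time `t` of a sequence of state-control
pairs: `∑_{s=1}^t |x(s) - θᵀ ψ(x(s-1), u(s-1)) - f(x(s-1), u(s-1))|² + γ |θ|_F²`. -/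
def rlsCost (h : ℕ → M.X × M.U) (t : ℕ) (θ : Param d n) : ℝ :=
  (∑ s ∈ Finset.range t, ‖((h (s + 1)).1 : E n) - trMul θ (M.ψ (h s)) - M.f (h s)‖ ^ 2)
    + M.γ * frobNorm θ ^ 2

/-- The regularised least squares estimate at time `t`: the minimiser of the cost for `t ≥ 1`, and
`ϑ₀` for `t = 0`. The minimiser exists and is unique because `γ > 0`. -/
def rls (h : ℕ → M.X × M.U) (t : ℕ) : Param d n :=
  if t = 0 then M.ϑ₀ else Classical.epsilon fun θ => ∀ θ', M.rlsCost h t θ ≤ M.rlsCost h t θ'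

/-- The closed-loop state-control pairs up to time `t` (the values at later times are padding),
for the initial state `x₀`, process noise `w 1, w 2, …` and exploratory noise `s 0, s 1, …`. The
control at time `t + 1` uses the estimate at time `t`, the control at time `0` uses `ϑ₀`. -/
def history (x₀ : M.X) (w : ℕ → M.W) (s : ℕ → M.S) : ℕ → ℕ → M.X × M.U
  | 0 => fun _ => (x₀, M.α (x₀, s 0, M.ϑ₀))
  | t + 1 =>
    let h := history x₀ w s t
    let x := M.step (h t).1 (h t).2 (w (t + 1))
    Function.update h (t + 1) (x, M.α (x, s (t + 1), M.rls h t))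

/-- The closed-loop sequence of state-control pairs. -/
def traj (x₀ : M.X) (w : ℕ → M.W) (s : ℕ → M.S) (t : ℕ) : M.X × M.U := M.history x₀ w s t t

/-- The closed-loop sequence of parameter estimates. -/
def estimate (x₀ : M.X) (w : ℕ → M.W) (s : ℕ → M.S) (t : ℕ) : Param d n :=
  M.rls (M.traj x₀ w s) t

theorem history_eq (x₀ : M.X) (w : ℕ → M.W) (s : ℕ → M.S) (t i : ℕ) (hi : i ≤ t) :
    M.history x₀ w s t i = M.traj x₀ w s i := by
  induction t with
  | zero => obtain rfl : i = 0 := by omega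
            rfl
  | succ t ih =>
    rcases Nat.lt_or_ge t i with h | h
    · obtain rfl : i = t + 1 := by omega
      rfl
    · rw [← ih h]
      simp only [history]
      exact Function.update_of_ne (by omega) _ _

theorem rls_congr {h h' : ℕ → M.X × M.U} {t : ℕ} (hh : ∀ i ≤ t, h i = h' i) :
    M.rls h t = M.rls h' t := by
  have : M.rlsCost h t = M.rlsCost h' t := by
    funext θ
    unfold rlsCost
    congr 1
    refine Finset.sum_congr rfl fun s hs => ?_
    have := Finset.mem_range.1 hs
    rw [hh (s + 1) (by omega), hh s (by omega)]
  simp only [rls, this]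

/-- The estimate minimises the cost for `t ≥ 1`. -/
theorem rls_isMin (h : ℕ → M.X × M.U) {t : ℕ} (ht : t ≠ 0) (θ' : Param d n) :
    M.rlsCost h t (M.rls h t) ≤ M.rlsCost h t θ' := by
  have hcont : Continuous (M.rlsCost h t) := by
    unfold rlsCost frobNorm trMul
    have hz : ∀ z : E d, Continuous fun θ : Param d n =>
        Matrix.toEuclideanLin θ.transpose z := by
      intro z
      simp only [Matrix.toEuclideanLin, Matrix.toLpLin_apply]
      fun_prop
    have := fun s => hz (M.ψ (h s))
    fun_prop
  have hex : ∃ θ, ∀ θ', M.rlsCost h t θ ≤ M.rlsCost h t θ' := by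
    set c := M.rlsCost h t 0
    have hγ := M.γ_pos
    have hlow : ∀ (θ : Param d n) i j, M.γ * θ i j ^ 2 ≤ M.rlsCost h t θ := by
      intro θ i j
      have h1 : θ i j ^ 2 ≤ frobNorm θ ^ 2 := by
        rw [frobNorm, Real.sq_sqrt (by positivity)]
        calc θ i j ^ 2 ≤ ∑ j, θ i j ^ 2 :=
              Finset.single_le_sum (f := fun j => θ i j ^ 2) (fun _ _ => sq_nonneg _)
                (Finset.mem_univ j)
          _ ≤ _ := Finset.single_le_sum (f := fun i => ∑ j, θ i j ^ 2)
                (fun _ _ => Finset.sum_nonneg fun _ _ => sq_nonneg _) (Finset.mem_univ i)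
      have h2 := mul_le_mul_of_nonneg_left h1 hγ.le
      have h3 : 0 ≤ ∑ s ∈ Finset.range t,
          ‖((h (s + 1)).1 : E n) - trMul θ (M.ψ (h s)) - M.f (h s)‖ ^ 2 :=
        Finset.sum_nonneg fun _ _ => sq_nonneg _
      unfold rlsCost
      linarith
    have hc : 0 ≤ c := by
      show 0 ≤ M.rlsCost h t 0
      unfold rlsCost
      positivity
    set R := √(c / M.γ)
    have hK : IsCompact (Set.pi Set.univ fun _ : Fin d => Set.pi Set.univ fun _ : Fin n =>
        Set.Icc (-R) R) :=
      isCompact_univ_pi fun _ => isCompact_univ_pi fun _ => isCompact_Icc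
    have h0 : (0 : Param d n) ∈ Set.pi Set.univ fun _ : Fin d => Set.pi Set.univ fun _ : Fin n =>
        Set.Icc (-R) R := by
      have : 0 ≤ R := Real.sqrt_nonneg _
      intro i _ j _
      exact ⟨by simpa using this, by simpa using this⟩
    obtain ⟨θ, -, hθ⟩ := hK.exists_isMinOn ⟨0, h0⟩ hcont.continuousOn
    refine ⟨θ, fun η => ?_⟩
    by_cases hη : η ∈ Set.pi Set.univ fun _ : Fin d => Set.pi Set.univ fun _ : Fin n =>
        Set.Icc (-R) R
    · exact hθ hη
    · refine (hθ h0).trans ?_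
      by_contra hlt
      refine hη fun i _ j _ => ?_
      have h1 : M.γ * η i j ^ 2 ≤ c := (hlow η i j).trans (not_le.1 hlt).le
      have h2 : |η i j| ≤ R := Real.abs_le_sqrt (by rw [le_div_iff₀ hγ]; linarith)
      exact abs_le.1 h2
  simp only [rls, ht, if_false]
  exact Classical.epsilon_spec hex θ'

/-- The initial state is `x₀`. -/
theorem traj_zero_fst (x₀ : M.X) (w : ℕ → M.W) (s : ℕ → M.S) : (M.traj x₀ w s 0).1 = x₀ := rfl

/-- The state equation `X(t+1) = f(X(t), U(t)) + θᵀ ψ(X(t), U(t)) + W(t+1)`. -/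
theorem traj_succ_fst (x₀ : M.X) (w : ℕ → M.W) (s : ℕ → M.S) (t : ℕ) :
    ((M.traj x₀ w s (t + 1)).1 : E n) =
      M.f (M.traj x₀ w s t) + trMul M.θ (M.ψ (M.traj x₀ w s t)) + (w (t + 1) : E n) := by
  simp only [traj, history, Function.update_self]
  rfl

/-- The control equation `U(t) = α(X(t), S(t), θ̂(t-1))`, where `θ̂(-1) = θ̂(0) = ϑ₀` (natural-number
subtraction gives `0 - 1 = 0`). -/
theorem traj_snd (x₀ : M.X) (w : ℕ → M.W) (s : ℕ → M.S) (t : ℕ) :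
    (M.traj x₀ w s t).2 = M.α ((M.traj x₀ w s t).1, s t, M.estimate x₀ w s (t - 1)) := by
  cases t with
  | zero => simp [traj, history, estimate, rls]
  | succ t =>
    have : M.rls (M.history x₀ w s t) t = M.estimate x₀ w s t :=
      M.rls_congr fun i hi => M.history_eq x₀ w s t i hi
    simp only [Nat.add_sub_cancel, ← this]
    simp only [traj, history, Function.update_self]

end Model

/-! ### Comparison functions -/

/-- Class `K_∞`. -/
structure IsKInf (χ : ℝ≥0 → ℝ≥0) : Prop where
  continuous : Continuous χ
  strictMono : StrictMono χ
  map_zero : χ 0 = 0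
  tendsto : Tendsto χ atTop atTop

/-- `k`-order sub-exponential: `ln (h (r ^ k)) = o(r)` as `r → ∞`. -/
def IsSubExp (k : ℕ) (h : ℝ≥0 → ℝ≥0) : Prop :=
  Tendsto (fun r : ℝ≥0 => Real.log (h (r ^ k)) / (r : ℝ)) atTop (𝓝 0)

/-- Asymptotically polynomially bounded: `h(r) = O(r ^ k)` for some natural number `k`. -/
def IsAPB (h : ℝ≥0 → ℝ≥0) : Prop :=
  ∃ k : ℕ, (fun r : ℝ≥0 => (h r : ℝ)) =O[atTop] fun r : ℝ≥0 => (r : ℝ) ^ k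

/-- The functions and constants that appear in the growth assumptions. -/
structure Growth where
  χ₁ : ℝ≥0 → ℝ≥0
  χ₂ : ℝ≥0 → ℝ≥0
  χ₃ : ℝ≥0 → ℝ≥0
  χ₄ : ℝ≥0 → ℝ≥0
  χ₅ : ℝ≥0 → ℝ≥0
  σ₁ : ℝ≥0 → ℝ≥0
  σ₂ : ℝ≥0 → ℝ≥0
  c₁ : ℝ≥0
  uMax : ℝ≥0

section Assumptions

variable {n m d q : ℕ} (M : Model n m d q)

/-- Measurability of the system mappings (with respect to the Borel σ-fields). -/
structure MeasurableMaps : Prop where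
  f : Measurable M.f
  ψ : Measurable M.ψ
  α : Measurable M.α

/-- The noise assumption. `W (t + 1)`, `t = 0, 1, …`, is the process noise (`W 0` is never used) and
`S t`, `t = 0, 1, …`, the exploratory noise: `W(1), W(2), …` are i.i.d. with law `μw`,
`S(0), S(1), …` are i.i.d. with law `μs`, the two sequences are independent of each other, and the
process noise is zero-mean and `σw²`-sub-Gaussian. -/
structure NoiseAssumption {Ω : Type*} [MeasurableSpace Ω] (P : Measure Ω)
    (W : ℕ → Ω → M.W) (S : ℕ → Ω → M.S) (μw : Measure M.W) (μs : Measure M.S) (σw : ℝ≥0) :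
    Prop where
  measurable_W : ∀ t, Measurable (W (t + 1))
  measurable_S : ∀ t, Measurable (S t)
  law_W : ∀ t, P.map (W (t + 1)) = μw
  law_S : ∀ t, P.map (S t) = μs
  indep_W : iIndepFun (fun t => W (t + 1)) P
  indep_S : iIndepFun S P
  indep_W_S : IndepFun (fun ω (t : ℕ) => W (t + 1) ω) (fun ω (t : ℕ) => S t ω) P
  mean_zero : ∀ t, ∫ ω, (W (t + 1) ω : E n) ∂P = 0
  subGaussian : ∀ t, ∀ ζ : E n, ‖ζ‖ = 1 →
    HasSubgaussianMGF (fun ω => ⟪ζ, (W (t + 1) ω : E n)⟫) (σw ^ 2) P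

/-- The sub-exponential input-to-state bound on reachable states, at all times `t = 0, 1, …`. -/
structure StateBound (G : Growth) : Prop where
  χ₁ : IsKInf G.χ₁ ∧ IsSubExp 1 G.χ₁
  χ₂ : IsKInf G.χ₂
  χ₃ : IsKInf G.χ₃ ∧ IsSubExp 1 G.χ₃
  χ₄ : IsKInf G.χ₄ ∧ IsSubExp 2 G.χ₄
  σ₁ : IsKInf G.σ₁
  σ₂ : IsKInf G.σ₂ ∧ IsSubExp 1 G.σ₂
  bound : ∀ (t : ℕ) (ξ : M.X) (u : ℕ → M.U) (w : ℕ → M.W),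
    ‖(M.solution ξ u w t : E n)‖₊ ≤ G.χ₁ t + G.χ₂ ‖(ξ : E n)‖₊
      + G.χ₃ (∑ i ∈ Finset.range t, G.σ₁ ‖(u i : E m)‖₊)
      + G.χ₄ (∑ i ∈ Finset.Icc 1 t, G.σ₂ ‖(w i : E n)‖₊) + G.c₁

/-- Constrained controls. -/
def ConstrainedControls (G : Growth) : Prop :=
  ∀ (x : M.X) (s : M.S) (ϑ : Param d n), ‖(M.α (x, s, ϑ) : E m)‖₊ ≤ G.uMax

/-- The basis functions are bounded by a nondecreasing, asymptotically polynomially bounded function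
of the Euclidean norm of the stacked vector of state and control. -/
structure BasisBound (G : Growth) : Prop where
  apb : IsAPB G.χ₅
  mono : Monotone G.χ₅
  bound : ∀ (x : M.X) (u : M.U),
    ‖M.ψ (x, u)‖₊ ≤ G.χ₅ (NNReal.sqrt (‖(x : E n)‖₊ ^ 2 + ‖(u : E m)‖₊ ^ 2))

/-- Regional excitation over `XPE ⊆ X` with constants `c, p > 0`: for all parameters `ϑ`, all
`x ∈ XPE` and all unit vectors `ζ`, the probability under `(S, W) ∼ μs × μw` that
`|ζᵀ ψ(x + W, α(x + W, S, ϑ))|² ≥ c` is at least `p`. (The expression presupposes `x + W ∈ X`, which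
is made part of the event.) -/
structure RegionallyExcited (μs : Measure M.S) (μw : Measure M.W) (XPE : Set (E n)) (c p : ℝ) :
    Prop where
  subset : XPE ⊆ M.X
  c_pos : 0 < c
  p_pos : 0 < p
  excited : ∀ (ϑ : Param d n), ∀ x ∈ XPE, ∀ ζ : E d, ‖ζ‖ = 1 →
    ENNReal.ofReal p ≤ (μs.prod μw) {a : M.S × M.W | ∃ h : x + (a.2 : E n) ∈ M.X,
      c ≤ |⟪ζ, M.ψ (⟨x + (a.2 : E n), h⟩, M.α (⟨x + (a.2 : E n), h⟩, a.1, ϑ))⟫| ^ 2}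

end Assumptions

/-! ### Bounds and times -/

/-- The process noise bound. -/
def wBar (n : ℕ) (σw : ℝ≥0) (t : ℕ) (δ : ℝ) : ℝ≥0 :=
  if t = 0 then 0
  else σw * Real.toNNReal (√(2 * n * Real.log (n * Real.pi ^ 2 * (t : ℝ) ^ 2 / (3 * δ))))

/-- The state bound, with `r = |x₀|`. -/
def xBar (G : Growth) (n : ℕ) (σw : ℝ≥0) (t : ℕ) (δ : ℝ) (r : ℝ≥0) : ℝ≥0 :=
  G.χ₁ t + G.χ₂ r + G.χ₃ (t * G.σ₁ G.uMax) + G.χ₄ (t * G.σ₂ (wBar n σw t δ)) + G.c₁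

/-- The regressor bound (for `t ≥ 1`). -/
def zBar (G : Growth) (n : ℕ) (σw : ℝ≥0) (t : ℕ) (δ : ℝ) (r : ℝ≥0) : ℝ≥0 :=
  G.χ₅ (NNReal.sqrt (xBar G n σw (t - 1) δ r ^ 2 + G.uMax ^ 2))

/-- `∑_{i=1}^t z̄(i)²`. -/
def sumZBar (G : Growth) (n : ℕ) (σw : ℝ≥0) (t : ℕ) (δ : ℝ) (r : ℝ≥0) : ℝ :=
  ∑ i ∈ Finset.Icc 1 t, (zBar G n σw i δ r : ℝ) ^ 2

section Times

variable {n m d q : ℕ} (M : Model n m d q) (G : Growth) (σw : ℝ≥0)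

/-- The Gramian upper bound. -/
def betaMax (t : ℕ) (δ : ℝ) (x₀ : M.X) : ℝ := sumZBar G n σw t δ ‖(x₀ : E n)‖₊ + M.γ

/-- The one-step predicted reachable set `{g(x, u, 0) | x ∈ A, |u| ≤ u_max}`. -/
def reach (A : Set (E n)) : Set (E n) :=
  {y | ∃ (x : M.X) (u : M.U), (x : E n) ∈ A ∧ ‖(u : E m)‖₊ ≤ G.uMax ∧ y = M.predict x u}

/-- The excited time bound, a supremum in `ℕ ∪ {∞}`. -/
def tExcited (XPE : Set (E n)) (δ : ℝ) (x₀ : M.X) : ℕ∞ :=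
  ⨆ (T : ℕ) (_ : 1 ≤ T ∧
    reach M G (Metric.closedBall 0 (xBar G n σw (T - 1) (δ / 3) ‖(x₀ : E n)‖₊) ∩ M.X) ⊆ XPE),
    (T : ℕ∞)

/-- The condition that defines the burn-in time. At `t = T = 1`, where the denominator vanishes, the
inequality fails for every `δ ∈ (0, 1)`, whatever value is given to the quotient in `[0, ∞]`. -/
def BurnedIn (c p : ℝ) (δ : ℝ) (x₀ : M.X) (T : ℕ) : Prop :=
  ∀ t : ℕ, T ≤ t →
    2 / ((1 - Real.log 2) * p) *
      (d * Real.log (1 + 16 * sumZBar G n σw t (δ / 3) ‖(x₀ : E n)‖₊ / (c * p * ((t : ℝ) - 1)))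
        + Real.log (Real.pi ^ 2 * ((t : ℝ) - T + 1) ^ 2 / (2 * δ))) + 1 ≤ (t : ℝ)

/-- The burn-in time bound, an infimum in `ℕ ∪ {∞}` (the infimum of the empty set is `∞`). -/
def tBurnIn (c p : ℝ) (δ : ℝ) (x₀ : M.X) : ℕ∞ :=
  ⨅ (T : ℕ) (_ : 1 ≤ T ∧ BurnedIn M G σw c p δ x₀ T), (T : ℕ∞)

/-- The error bound. -/
def errBound (c p : ℝ) (t : ℕ) (δ : ℝ) (x₀ : M.X) : ℝ :=
  1 / √(c * p / 4 * ((t : ℝ) - 1) + M.γ) *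
    (√M.γ * frobNorm M.θ + σw * √(2 * n * (Real.log (3 * n / δ)
      + (d : ℝ) / 2 * Real.log (betaMax M G σw t (δ / 3) x₀ * M.γ⁻¹))))

end Times

end SysId

end

noncomputable section

namespace SysId

/-! ### Independence, one-step integration and Ville's inequality -/

section Probability

variable {Ω : Type*} [MeasurableSpace Ω] {P : Measure Ω} [IsProbabilityMeasure P]

/-! Put V = γ I + ∑ ψψᵀ and N = ∑ ψ wᵀ. First-order optimality gives V (θ̂ - θ_*) = N - γ θ_*. In
the norm of V the error is at most √γ |θ_*|_F plus the self-normalised size of the columns of N, and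
a bound V ≥ l I turns this into a spectral norm bound with factor 1/√l (`specNorm_le_of_mul_eq`).
Three events, each failing with probability at most δ/3, supply the rest.

Noise: a sub-Gaussian union bound over coordinates and times gives |W(t)| ≤ w̄(t, δ/3) for all t ≥
1. The state bound then keeps X(t) in the ball of radius x̄(t, δ/3), which bounds the regressors and
hence det V.

Self-normalisation: for each column N_j, (det V / γ^d)^(-1/2) exp(N_jᵀ V⁻¹ N_j / (2σ²)) is a
nonnegative supermartingale, because a rank-one update multiplies it by a normal mixture of
sub-Gaussian exponentials (`selfNormMart_advance`, `lintegral_exp_quadratic_le`). Ville's inequality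
at level 3n/δ handles all times at once.

Excitation: up to the excited time, the prediction from a bounded state lies in the excited region,
so the next regressor has energy at least c in a given direction with conditional probability at
least p. An exponential supermartingale counting these hits bounds the probability of energy below
cp(t-1)/2 by exp(-(1 - ln 2) p (t-1)/2). A net of the sphere extends this to all directions at half
the level, at the price of a factor (1 + 16Z/(cp(t-1)))^d. The burn-in condition makes the result at
most 2δ/(π²(t-T+1)²), and these weights sum to δ/3 over t ≥ T.

The burn-in time is finite because the growth assumptions make ∑ z̄² subexponential, so that its
logarithm is o(t). Conditional expectations are not needed: the history is a recursion driven by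
noise independent of the past, and Tonelli's theorem integrates that noise out. -/

theorem prod_map_prodProdProdComm {α β γ δ : Type*} [MeasurableSpace α] [MeasurableSpace β]
    [MeasurableSpace γ] [MeasurableSpace δ] (μ : Measure α) (ν : Measure β) (ρ : Measure γ)
    (κ : Measure δ) [IsProbabilityMeasure μ] [IsProbabilityMeasure ν] [IsProbabilityMeasure ρ]
    [IsProbabilityMeasure κ] :
    (((μ.prod ν).prod (ρ.prod κ)).map fun x => ((x.1.1, x.2.1), (x.1.2, x.2.2)))
      = (μ.prod ρ).prod (ν.prod κ) := by
  symm
  refine Measure.prod_eq_generateFrom (generateFrom_prod (α := α) (β := γ))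
    (generateFrom_prod (α := β) (β := δ)) isPiSystem_prod isPiSystem_prod
    ⟨fun _ => Set.univ, fun _ => ⟨Set.univ, MeasurableSet.univ, Set.univ, MeasurableSet.univ,
      Set.univ_prod_univ⟩, fun _ => by simp, by simp [Set.iUnion_const]⟩
    ⟨fun _ => Set.univ, fun _ => ⟨Set.univ, MeasurableSet.univ, Set.univ, MeasurableSet.univ,
      Set.univ_prod_univ⟩, fun _ => by simp, by simp [Set.iUnion_const]⟩ ?_
  rintro _ ⟨a, ha, c, hc, rfl⟩ _ ⟨b, hb, e, he, rfl⟩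
  simp only [Set.mem_ofPred_eq] at ha hc hb he
  rw [Measure.map_apply (by fun_prop) ((ha.prod hc).prod (hb.prod he))]
  have : (fun x : (α × β) × γ × δ => ((x.1.1, x.2.1), (x.1.2, x.2.2))) ⁻¹'
      ((a ×ˢ c) ×ˢ (b ×ˢ e)) = (a ×ˢ b) ×ˢ (c ×ˢ e) := by
    ext; simp; tauto
  rw [this]
  simp only [Measure.prod_prod]
  ring

/-- Meant for `A`, `B` the past and the next process noise and `C`, `D` the past and the next
exploratory noise: the law of all four is a fourfold product, so they may be regrouped as past
against future. -/
theorem indepFun_prodMk_prodMk {α β γ δ : Type*} [MeasurableSpace α] [MeasurableSpace β]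
    [MeasurableSpace γ] [MeasurableSpace δ] {A : Ω → α} {B : Ω → β} {C : Ω → γ} {D : Ω → δ}
    (hA : Measurable A) (hB : Measurable B) (hC : Measurable C) (hD : Measurable D)
    (hAB : IndepFun A B P) (hCD : IndepFun C D P)
    (h : IndepFun (fun ω => (A ω, B ω)) (fun ω => (C ω, D ω)) P) :
    IndepFun (fun ω => (A ω, C ω)) (fun ω => (B ω, D ω)) P := by
  have := Measure.isProbabilityMeasure_map (μ := P) hA.aemeasurable
  have := Measure.isProbabilityMeasure_map (μ := P) hB.aemeasurable
  have := Measure.isProbabilityMeasure_map (μ := P) hC.aemeasurable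
  have := Measure.isProbabilityMeasure_map (μ := P) hD.aemeasurable
  have hAC : IndepFun A C P := h.comp measurable_fst measurable_fst
  have hBD : IndepFun B D P := h.comp measurable_snd measurable_snd
  rw [indepFun_iff_map_prod_eq_prod_map_map (by fun_prop) (by fun_prop)] at hAB hCD h hAC hBD ⊢
  rw [hAC, hBD, ← prod_map_prodProdProdComm, ← hAB, ← hCD, ← h,
    Measure.map_map (by fun_prop) (by fun_prop)]
  rfl

/-- Plays the role of conditioning on `Y`: the joint law is a product, so the fresh variable is
integrated out first. -/
theorem lintegral_le_of_indepFun {β Z : Type*} [MeasurableSpace β] [MeasurableSpace Z]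
    {Y : Ω → β} {ξ : Ω → Z} (hY : Measurable Y) (hξ : Measurable ξ) (h : IndepFun Y ξ P)
    {F : β × Z → ℝ≥0∞} (hF : Measurable F) {G : β → ℝ≥0∞} (hG : Measurable G)
    (hFG : ∀ y, ∫⁻ z, F (y, z) ∂(P.map ξ) ≤ G y) :
    ∫⁻ ω, F (Y ω, ξ ω) ∂P ≤ ∫⁻ ω, G (Y ω) ∂P := by
  have := Measure.isProbabilityMeasure_map (μ := P) hY.aemeasurable
  have := Measure.isProbabilityMeasure_map (μ := P) hξ.aemeasurable
  rw [indepFun_iff_map_prod_eq_prod_map_map (by fun_prop) (by fun_prop)] at h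
  rw [← lintegral_map (g := fun ω => (Y ω, ξ ω)) hF (by fun_prop), h, lintegral_prod _ (by fun_prop),
    ← lintegral_map hG hY]
  exact lintegral_mono hFG

open Classical in
/-- A sequence of functions stopped when it first reaches the level `a`. -/
def stopAbove {β : Type*} (K : ℕ → β → ℝ≥0∞) (a : ℝ≥0∞) : ℕ → β → ℝ≥0∞
  | 0 => K 0
  | t + 1 => fun y => if a ≤ stopAbove K a t y then stopAbove K a t y else K (t + 1) y

/-- Ville's inequality for a nonnegative supermartingale that is a functional of a recursively
generated process: `Y (t + 1) = Φ t (Y t) (ξ t)` with `ξ t` independent of `Y t`. -/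
theorem measure_exists_le_of_supermartingale {β Z : Type*} [MeasurableSpace β] [MeasurableSpace Z]
    {Y : ℕ → Ω → β} {ξ : ℕ → Ω → Z} {Φ : ℕ → β × Z → β}
    (hY : ∀ t, Measurable (Y t)) (hξ : ∀ t, Measurable (ξ t)) (hΦ : ∀ t, Measurable (Φ t))
    (hrec : ∀ t ω, Y (t + 1) ω = Φ t (Y t ω, ξ t ω))
    (hind : ∀ t, IndepFun (Y t) (ξ t) P)
    {K : ℕ → β → ℝ≥0∞} (hK : ∀ t, Measurable (K t)) (hK0 : ∀ y, K 0 y ≤ 1)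
    (hKΦ : ∀ t i, i ≤ t → ∀ y z, K i (Φ t (y, z)) = K i y)
    (hstep : ∀ t y, ∫⁻ z, K (t + 1) (Φ t (y, z)) ∂(P.map (ξ t)) ≤ K t y)
    {a : ℝ≥0∞} (ha : a ≠ 0) (ha' : a ≠ ⊤) :
    P {ω | ∃ t, a ≤ K t (Y t ω)} ≤ a⁻¹ := by
  classical
  set N : ℕ → β → ℝ≥0∞ := stopAbove K a
  have hNs : ∀ t, N (t + 1) = fun y => if a ≤ N t y then N t y else K (t + 1) y := fun t => rfl
  have hNm : ∀ t : ℕ, Measurable (N t) := by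
    intro t
    induction t with
    | zero => exact hK 0
    | succ t ih =>
      rw [hNs]
      exact Measurable.ite (measurableSet_le measurable_const ih) ih (hK _)
  have hNΦ : ∀ i t, i ≤ t → ∀ y z, N i (Φ t (y, z)) = N i y := by
    intro i
    induction i with
    | zero => intro t ht y z; exact hKΦ t 0 ht y z
    | succ i ih =>
      intro t ht y z
      simp only [hNs]
      rw [ih t (by omega), hKΦ t (i + 1) ht]
  have hNK : ∀ t y, ¬ a ≤ N t y → N t y = K t y := by
    intro t y h
    cases t with
    | zero => rfl
    | succ t =>
      simp only [hNs] at h ⊢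
      by_cases h1 : a ≤ N t y
      · simp only [h1, if_true, not_true_eq_false] at h
      · simp only [h1, if_false]
  have hprob : ∀ t, IsProbabilityMeasure (P.map (ξ t)) := fun t =>
    Measure.isProbabilityMeasure_map (hξ t).aemeasurable
  -- Stopping preserves the supermartingale property: once the level is reached the value is frozen,
  -- and before that `N` agrees with `K`, to which the one-step bound applies.
  have hint : ∀ t, ∫⁻ ω, N t (Y t ω) ∂P ≤ 1 := by
    intro t
    induction t with
    | zero =>
      calc _ ≤ ∫⁻ ω, 1 ∂P := lintegral_mono fun ω => hK0 _
        _ = 1 := by simp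
    | succ t ih =>
      refine le_trans ?_ ih
      simp only [hrec]
      refine lintegral_le_of_indepFun (hY t) (hξ t) (hind t)
        (F := fun x => N (t + 1) (Φ t x)) ((hNm (t + 1)).comp (hΦ t)) (hNm t) fun y => ?_
      have := hprob t
      simp only [hNs, hNΦ t t le_rfl]
      by_cases h : a ≤ N t y
      · simp [h]
      · simp only [h, if_false]
        rw [hNK t y h]
        exact hstep t y
  have hex : ∀ t ω, (∃ i ≤ t, a ≤ K i (Y t ω)) → a ≤ N t (Y t ω) := by
    have : ∀ t y, (∃ i ≤ t, a ≤ K i y) → a ≤ N t y := by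
      intro t y
      induction t with
      | zero =>
        rintro ⟨i, hi, h⟩
        obtain rfl : i = 0 := by omega
        exact h
      | succ t ih =>
        rintro ⟨i, hi, h⟩
        simp only [hNs]
        split_ifs with h1
        · exact h1
        · rcases Nat.lt_or_ge t i with h2 | h2
          · obtain rfl : i = t + 1 := by omega
            exact h
          · exact absurd (ih ⟨i, h2, h⟩) h1
    exact fun t ω => this t _
  have hKY : ∀ t i ω, i ≤ t → K i (Y t ω) = K i (Y i ω) := by
    intro t i ω hi
    induction t with
    | zero => obtain rfl : i = 0 := by omega
              rfl
    | succ t ih =>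
      rcases Nat.lt_or_ge t i with h2 | h2
      · obtain rfl : i = t + 1 := by omega
        rfl
      · rw [hrec, hKΦ t i h2, ih h2]
  have hset : {ω | ∃ t, a ≤ K t (Y t ω)} = ⋃ t, {ω | ∃ i ≤ t, a ≤ K i (Y t ω)} := by
    ext ω
    simp only [Set.mem_ofPred_eq, Set.mem_iUnion]
    constructor
    · rintro ⟨t, h⟩
      exact ⟨t, t, le_rfl, h⟩
    · rintro ⟨t, i, hi, h⟩
      exact ⟨i, by rwa [hKY t i ω hi] at h⟩
  -- Since `K i` ignores steps after `i`, the finite-horizon events increase, and Markov's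
  -- inequality for the stopped process passes to the limit.
  have hmono : Monotone fun t => {ω | ∃ i ≤ t, a ≤ K i (Y t ω)} := by
    intro s t hst ω
    rintro ⟨i, hi, h⟩
    refine ⟨i, hi.trans hst, ?_⟩
    rwa [hKY t i ω (hi.trans hst), ← hKY s i ω hi]
  rw [hset, hmono.measure_iUnion]
  refine iSup_le fun t => ?_
  calc _ ≤ P {ω | a ≤ N t (Y t ω)} := measure_mono fun ω => hex t ω
    _ ≤ (∫⁻ ω, N t (Y t ω) ∂P) / a :=
      meas_ge_le_lintegral_div ((hNm t).comp (hY t)).aemeasurable ha ha'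
    _ ≤ 1 / a := by gcongr; exact hint t
    _ = a⁻¹ := one_div a

end Probability

/-! ### A Gaussian mixture of exponential moments -/

/-- Completing the square in `l`: the leading coefficient -(1+a)/(2a) identifies the tilted density
as normal with variance a/(1+a), and √(1+a) is the ratio of the normalising constants. -/
theorem gaussianPDFReal_mul_exp {a : ℝ≥0} (ha : a ≠ 0) (b x l : ℝ) :
    gaussianPDFReal b a l * Real.exp (l * x - l ^ 2 / 2) =
      (√(1 + a))⁻¹ * Real.exp ((2 * b * x + a * x ^ 2 - b ^ 2) / (2 * (1 + a)))
        * gaussianPDFReal ((b + a * x) / (1 + a)) (a / (1 + a)) l := by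
  have ha0 : (0 : ℝ) < a := by positivity
  unfold gaussianPDFReal
  have h1 : √(2 * Real.pi * a) = √(1 + a) * √(2 * Real.pi * (a / (1 + a) : ℝ≥0)) := by
    rw [← Real.sqrt_mul (by positivity)]
    congr 1
    push_cast
    field_simp
  rw [h1]
  have h2 : Real.exp (-(l - b) ^ 2 / (2 * a)) * Real.exp (l * x - l ^ 2 / 2) =
      Real.exp ((2 * b * x + a * x ^ 2 - b ^ 2) / (2 * (1 + a))) *
      Real.exp (-(l - (b + a * x) / (1 + a)) ^ 2 / (2 * (a / (1 + a) : ℝ≥0))) := by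
    rw [← Real.exp_add, ← Real.exp_add]
    congr 1
    push_cast
    field_simp
    ring
  rw [mul_inv]
  linear_combination (√(1 + a))⁻¹ * (√(2 * Real.pi * (a / (1 + a) : ℝ≥0)))⁻¹ * h2

theorem lintegral_exp_gaussianReal (a : ℝ≥0) (b x : ℝ) :
    ∫⁻ l, ENNReal.ofReal (Real.exp (l * x - l ^ 2 / 2)) ∂(gaussianReal b a) =
      ENNReal.ofReal ((√(1 + a))⁻¹ * Real.exp ((2 * b * x + a * x ^ 2 - b ^ 2) / (2 * (1 + a)))) := by
  -- With zero variance the normal law is the point mass at `b` and has no density.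
  by_cases ha : a = 0
  · subst ha
    rw [gaussianReal_zero_var, lintegral_dirac]
    simp only [NNReal.coe_zero, add_zero, Real.sqrt_one, inv_one, one_mul, zero_mul, mul_one]
    congr 2
    ring
  · rw [gaussianReal_of_var_ne_zero _ ha,
      lintegral_withDensity_eq_lintegral_mul _ (measurable_gaussianPDF _ _) (by fun_prop)]
    have : ∀ l, (gaussianPDF b a * fun l => ENNReal.ofReal (Real.exp (l * x - l ^ 2 / 2))) l =
        ENNReal.ofReal ((√(1 + a))⁻¹ * Real.exp ((2 * b * x + a * x ^ 2 - b ^ 2) / (2 * (1 + a))))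
        * gaussianPDF ((b + a * x) / (1 + a)) (a / (1 + a)) l := by
      intro l
      simp only [Pi.mul_apply, gaussianPDF]
      rw [← ENNReal.ofReal_mul (gaussianPDFReal_nonneg _ _ _), gaussianPDFReal_mul_exp ha,
        ENNReal.ofReal_mul (by positivity)]
    simp only [this]
    rw [lintegral_const_mul _ (measurable_gaussianPDF _ _), lintegral_gaussianPDF_eq_one, mul_one]
    exact div_ne_zero ha (by positivity)

/-- The exponential of a quadratic form of a `1`-sub-Gaussian variable, obtained by mixing its
moment generating function over a normal law. -/
theorem lintegral_exp_quadratic_le {Z : Type*} [MeasurableSpace Z] {μ : Measure Z} [SFinite μ]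
    {X : Z → ℝ} (hX : Measurable X)
    (hsub : ∀ l : ℝ, ∫⁻ z, ENNReal.ofReal (Real.exp (l * X z - l ^ 2 / 2)) ∂μ ≤ 1)
    {a : ℝ} (ha : 0 ≤ a) (b : ℝ) :
    ∫⁻ z, ENNReal.ofReal ((√(1 + a))⁻¹ *
      Real.exp ((2 * b * X z + a * X z ^ 2 - b ^ 2) / (2 * (1 + a)))) ∂μ ≤ 1 := by
  lift a to ℝ≥0 using ha
  simp only [← lintegral_exp_gaussianReal]
  rw [lintegral_lintegral_swap (by fun_prop)]
  calc _ ≤ ∫⁻ _, 1 ∂(gaussianReal b a) := lintegral_mono hsub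
    _ = 1 := by simp

/-! ### A net of the unit sphere -/

open Metric Module in
-- Volume comparison: the balls of radius ε/2 about the points are disjoint and lie in the ball of
-- radius 1 + ε/2.
theorem card_le_of_pairwise_separated {V : Type*} [NormedAddCommGroup V] [NormedSpace ℝ V]
    [FiniteDimensional ℝ V] {ε : ℝ} (hε : 0 < ε) (s : Finset V) (hs : ∀ x ∈ s, ‖x‖ ≤ 1)
    (h : ∀ x ∈ s, ∀ y ∈ s, x ≠ y → ε ≤ ‖x - y‖) :
    (s.card : ℝ) ≤ (1 + 2 / ε) ^ finrank ℝ V := by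
  borelize V
  let μ : Measure V := Measure.addHaar
  have hD : Set.Pairwise (s : Set V) (Function.onFun Disjoint fun x => ball x (ε / 2)) := by
    intro x hx y hy hxy
    apply ball_disjoint_ball
    rw [dist_eq_norm]
    linarith [h x hx y hy hxy]
  have hsub : (⋃ x ∈ s, ball x (ε / 2)) ⊆ ball (0 : V) (1 + ε / 2) := by
    refine Set.iUnion₂_subset fun x hx => ball_subset_ball' ?_
    rw [dist_zero_right]
    linarith [hs x hx]
  have hρ : 0 < 1 + ε / 2 := by positivity
  have I : (s.card : ℝ≥0∞) * ENNReal.ofReal ((ε / 2) ^ finrank ℝ V) * μ (ball 0 1) ≤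
      ENNReal.ofReal ((1 + ε / 2) ^ finrank ℝ V) * μ (ball 0 1) :=
    calc
      _ = μ (⋃ x ∈ s, ball x (ε / 2)) := by
        rw [measure_biUnion_finset hD fun x _ => measurableSet_ball]
        simp only [μ.addHaar_ball_of_pos _ (half_pos hε), Finset.sum_const, nsmul_eq_mul, mul_assoc]
      _ ≤ μ (ball (0 : V) (1 + ε / 2)) := measure_mono hsub
      _ = _ := by simp only [μ.addHaar_ball_of_pos _ hρ]
  have J := (ENNReal.mul_le_mul_iff_left (measure_ball_pos μ _ zero_lt_one).ne'
    measure_ball_lt_top.ne).1 I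
  have K := ENNReal.toReal_le_of_le_ofReal (pow_nonneg hρ.le _) J
  rw [ENNReal.toReal_mul, ENNReal.toReal_natCast, ENNReal.toReal_ofReal (by positivity)] at K
  have hp : (0 : ℝ) < (ε / 2) ^ finrank ℝ V := by positivity
  calc (s.card : ℝ) ≤ (1 + ε / 2) ^ finrank ℝ V / (ε / 2) ^ finrank ℝ V := by rwa [le_div_iff₀ hp]
    _ = (1 + 2 / ε) ^ finrank ℝ V := by
      rw [← div_pow]
      congr 1
      field_simp
      ring

/-- A separated subset of the sphere of maximal cardinality is a net, since a point far from all of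
it could be added. The volume bound makes a maximum exist. -/
theorem exists_net_unit_sphere {V : Type*} [NormedAddCommGroup V] [NormedSpace ℝ V]
    [FiniteDimensional ℝ V] {ε : ℝ} (hε : 0 < ε) :
    ∃ s : Finset V, (∀ x ∈ s, ‖x‖ = 1) ∧
      (s.card : ℝ) ≤ (1 + 2 / ε) ^ Module.finrank ℝ V ∧
      ∀ x : V, ‖x‖ = 1 → ∃ y ∈ s, ‖x - y‖ ≤ ε := by
  classical
  let p : Finset V → Prop := fun s => (∀ x ∈ s, ‖x‖ = 1) ∧
    ∀ x ∈ s, ∀ y ∈ s, x ≠ y → ε ≤ ‖x - y‖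
  have hp : ∀ s, p s → (s.card : ℝ) ≤ (1 + 2 / ε) ^ Module.finrank ℝ V := fun s hs =>
    card_le_of_pairwise_separated hε s (fun x hx => (hs.1 x hx).le) hs.2
  have hbdd : ∃ N, ∀ s, p s → s.card ≤ N :=
    ⟨⌊(1 + 2 / ε) ^ Module.finrank ℝ V⌋₊, fun s hs => Nat.le_floor (hp s hs)⟩
  let q : ℕ → Prop := fun k => ∃ s, p s ∧ s.card = k
  obtain ⟨N, hN⟩ := hbdd
  have hq0 : q 0 := ⟨∅, by simp [p], rfl⟩
  obtain ⟨s, hs, hcard⟩ : q (Nat.findGreatest q N) := Nat.findGreatest_spec (Nat.zero_le N) hq0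
  refine ⟨s, hs.1, hp s hs, fun x hx => ?_⟩
  by_contra! hfar
  have hxs : x ∉ s := fun hxs => by
    have := hfar x hxs
    simp only [sub_self, norm_zero] at this
    linarith
  have hins : p (insert x s) := by
    refine ⟨fun y hy => ?_, fun y hy z hz hyz => ?_⟩
    · rcases Finset.mem_insert.1 hy with rfl | hy
      · exact hx
      · exact hs.1 y hy
    · rcases Finset.mem_insert.1 hy with hy' | hy' <;> rcases Finset.mem_insert.1 hz with hz' | hz'
      · exact absurd (hy'.trans hz'.symm) hyz
      · rw [hy']; exact (hfar z hz').le
      · rw [hz', norm_sub_rev]; exact (hfar y hy').le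
      · exact hs.2 y hy' z hz' hyz
  have hle : (insert x s).card ≤ Nat.findGreatest q N :=
    Nat.le_findGreatest (hN _ hins) ⟨_, hins, rfl⟩
  rw [Finset.card_insert_of_notMem hxs] at hle
  omega

/-! ### Quadratic forms, rank-one updates and the determinant -/

section LinearAlgebra

open Matrix

variable {d n : ℕ} {V : Matrix (Fin d) (Fin d) ℝ}

theorem PosDef.isUnit_det (hV : V.PosDef) : IsUnit V.det :=
  (Matrix.isUnit_iff_isUnit_det V).1 hV.isUnit

theorem PosDef.dotProduct_mulVec_comm (hV : V.PosDef) (x y : Fin d → ℝ) :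
    x ⬝ᵥ V *ᵥ y = y ⬝ᵥ V *ᵥ x := by
  have h : Vᵀ = V := by simpa using hV.isHermitian.eq
  rw [dotProduct_mulVec, ← mulVec_transpose, h, dotProduct_comm]

theorem PosDef.add_vecMulVec (hV : V.PosDef) (u : Fin d → ℝ) : (V + vecMulVec u u).PosDef :=
  hV.add_posSemidef (by simpa using posSemidef_vecMulVec_self_star u)

theorem PosDef.dotProduct_inv_nonneg (hV : V.PosDef) (x : Fin d → ℝ) : 0 ≤ x ⬝ᵥ V⁻¹ *ᵥ x := by
  simpa using hV.inv.posSemidef.dotProduct_mulVec_nonneg x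

/-- The factor 1 + uᵀV⁻¹u is the square of the normalisation √(1+a) left by the normal mixture,
which is why the determinant is the right compensator. -/
theorem det_add_vecMulVec (hV : V.PosDef) (u : Fin d → ℝ) :
    (V + vecMulVec u u).det = V.det * (1 + u ⬝ᵥ V⁻¹ *ᵥ u) := by
  rw [vecMulVec_eq Unit, det_add_replicateCol_mul_replicateRow (PosDef.isUnit_det hV),
    det_unique (n := Unit), Matrix.mul_assoc]
  rfl

/-- The change of the quadratic form `x ↦ xᵀ V⁻¹ x` under the rank-one update
`V ↦ V + u uᵀ`, `x ↦ x + w u`. -/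
theorem dotProduct_inv_add_vecMulVec (hV : V.PosDef) (u x : Fin d → ℝ) (w : ℝ) :
    (x + w • u) ⬝ᵥ (V + vecMulVec u u)⁻¹ *ᵥ (x + w • u) = x ⬝ᵥ V⁻¹ *ᵥ x
      + (2 * (u ⬝ᵥ V⁻¹ *ᵥ x) * w + (u ⬝ᵥ V⁻¹ *ᵥ u) * w ^ 2 - (u ⬝ᵥ V⁻¹ *ᵥ x) ^ 2)
        / (1 + u ⬝ᵥ V⁻¹ *ᵥ u) := by
  have ha := PosDef.dotProduct_inv_nonneg hV u
  have hsymm := PosDef.dotProduct_mulVec_comm hV.inv x u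
  set a := u ⬝ᵥ V⁻¹ *ᵥ u
  set b := u ⬝ᵥ V⁻¹ *ᵥ x
  have hVV : ∀ y, V *ᵥ V⁻¹ *ᵥ y = y := fun y => by
    rw [mulVec_mulVec, mul_nonsing_inv _ (PosDef.isUnit_det hV), one_mulVec]
  -- Solves the updated system explicitly: with ansatz V⁻¹x + s V⁻¹u the coefficient of u is s(1+a)
  -- + b, which must equal w.
  have hsol : (V + vecMulVec u u) *ᵥ (V⁻¹ *ᵥ x + ((w - b) / (1 + a)) • V⁻¹ *ᵥ u) = x + w • u := by
    rw [add_mulVec, mulVec_add, mulVec_smul, hVV, hVV, vecMulVec_mulVec, dotProduct_add,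
      dotProduct_smul]
    change x + ((w - b) / (1 + a)) • u + MulOpposite.op (b + ((w - b) / (1 + a)) • a) • u = _
    ext i
    simp only [Pi.add_apply, Pi.smul_apply, smul_eq_mul, MulOpposite.smul_eq_mul_unop,
      MulOpposite.unop_op]
    field_simp
    ring
  rw [← hsol, mulVec_mulVec, nonsing_inv_mul _ (PosDef.isUnit_det (PosDef.add_vecMulVec hV u)),
    one_mulVec, hsol, add_dotProduct, dotProduct_add, dotProduct_add, smul_dotProduct,
    smul_dotProduct, dotProduct_smul, dotProduct_smul, hsymm]
  change x ⬝ᵥ V⁻¹ *ᵥ x + ((w - b) / (1 + a)) • b + (w • b + w • ((w - b) / (1 + a)) • a) = _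
  simp only [smul_eq_mul]
  field_simp
  ring

/-- Cauchy–Schwarz between the dual norms of V and V⁻¹, from the discriminant of t ↦ |x - t V⁻¹y|²
in the norm of V. -/
theorem sq_dotProduct_le (hV : V.PosDef) (x y : Fin d → ℝ) :
    (x ⬝ᵥ y) ^ 2 ≤ (x ⬝ᵥ V *ᵥ x) * (y ⬝ᵥ V⁻¹ *ᵥ y) := by
  have hVV : V *ᵥ V⁻¹ *ᵥ y = y := by
    rw [mulVec_mulVec, mul_nonsing_inv _ (PosDef.isUnit_det hV), one_mulVec]
  have h : ∀ t : ℝ, 0 ≤ (y ⬝ᵥ V⁻¹ *ᵥ y) * (t * t) + (-(2 * (x ⬝ᵥ y))) * t + x ⬝ᵥ V *ᵥ x := by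
    intro t
    have := hV.posSemidef.dotProduct_mulVec_nonneg (x - t • V⁻¹ *ᵥ y)
    have hxy : (V⁻¹ *ᵥ y) ⬝ᵥ V *ᵥ x = x ⬝ᵥ y := by
      rw [PosDef.dotProduct_mulVec_comm hV, hVV]
    simp only [star_trivial, mulVec_sub, mulVec_smul, hVV, sub_dotProduct, dotProduct_sub,
      smul_dotProduct, dotProduct_smul, smul_eq_mul, hxy] at this
    rw [dotProduct_comm (V⁻¹ *ᵥ y) y] at this
    linarith
  have := discrim_le_zero h
  unfold discrim at this
  linarith

/-- The Rayleigh quotient at a unit eigenvector bounds each eigenvalue by β. -/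
theorem det_le_pow (hV : V.PosDef) {β : ℝ} (hβ : ∀ x, x ⬝ᵥ V *ᵥ x ≤ β * (x ⬝ᵥ x)) :
    V.det ≤ β ^ d := by
  rw [hV.isHermitian.det_eq_prod_eigenvalues]
  calc ∏ i, (hV.isHermitian.eigenvalues i : ℝ) ≤ ∏ _i : Fin d, β := by
        refine Finset.prod_le_prod (fun i _ => (hV.eigenvalues_pos i).le) fun i _ => ?_
        have h1 := hβ (hV.isHermitian.eigenvectorBasis i).ofLp
        rw [hV.isHermitian.mulVec_eigenvectorBasis, dotProduct_smul, smul_eq_mul] at h1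
        have h2 : (hV.isHermitian.eigenvectorBasis i).ofLp ⬝ᵥ
            (hV.isHermitian.eigenvectorBasis i).ofLp = 1 := by
          have := hV.isHermitian.eigenvectorBasis.orthonormal.1 i
          have h3 := EuclideanSpace.real_norm_sq_eq (hV.isHermitian.eigenvectorBasis i)
          rw [this] at h3
          simp only [dotProduct, ← sq]
          linarith
        rw [h2] at h1
        linarith
    _ = β ^ d := by simp

theorem frobNorm_nonneg (A : Param d n) : 0 ≤ frobNorm A := Real.sqrt_nonneg _

theorem dotProduct_mulVec_self_le (A : Param d n) (v : Fin n → ℝ) :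
    (A *ᵥ v) ⬝ᵥ (A *ᵥ v) ≤ frobNorm A ^ 2 * (v ⬝ᵥ v) := by
  rw [frobNorm, Real.sq_sqrt (by positivity), dotProduct, Finset.sum_mul]
  refine Finset.sum_le_sum fun i _ => ?_
  have := Finset.sum_mul_sq_le_sq_mul_sq Finset.univ (A i) v
  simp only [mulVec, dotProduct, ← sq] at this ⊢
  exact this

theorem specNorm_le {A : Param d n} {r : ℝ} (hr : 0 ≤ r)
    (h : ∀ v, (A *ᵥ v) ⬝ᵥ (A *ᵥ v) ≤ r ^ 2 * (v ⬝ᵥ v)) : specNorm A ≤ r := by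
  refine ContinuousLinearMap.opNorm_le_bound _ hr fun v => ?_
  have h1 := h v.ofLp
  refine abs_le_of_sq_le_sq' ?_ (by positivity) |>.2
  rw [mul_pow, EuclideanSpace.real_norm_sq_eq, EuclideanSpace.real_norm_sq_eq]
  simp only [dotProduct, ← sq] at h1
  exact h1

/-- The error of a regularised least squares estimate, `V Δ = N - γ θ`, in terms of the
self-normalised columns of the noise term `N`. -/
theorem specNorm_le_of_mul_eq (hV : V.PosDef) {γ l B : ℝ} (hγ : 0 < γ) (hl : 0 < l) (hB : 0 ≤ B)
    (hVγ : ∀ x, γ * (x ⬝ᵥ x) ≤ x ⬝ᵥ V *ᵥ x) (hVl : ∀ x, l * (x ⬝ᵥ x) ≤ x ⬝ᵥ V *ᵥ x)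
    {D N θ : Param d n} (hD : V * D = N - γ • θ)
    (hN : ∀ j, N.col j ⬝ᵥ V⁻¹ *ᵥ N.col j ≤ B) :
    specNorm D ≤ 1 / √l * (√γ * frobNorm θ + √(n * B)) := by
  have hfθ := frobNorm_nonneg θ
  refine specNorm_le (by positivity) fun v => ?_
  set x := D *ᵥ v with hx
  have hVx : V *ᵥ x = N *ᵥ v - γ • θ *ᵥ v := by
    rw [hx, mulVec_mulVec, hD, sub_mulVec, smul_mulVec]
  set q := x ⬝ᵥ V *ᵥ x with hq
  have hxx : 0 ≤ x ⬝ᵥ x := by simpa using dotProduct_star_self_nonneg x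
  have hvv : 0 ≤ v ⬝ᵥ v := by simpa using dotProduct_star_self_nonneg v
  have hq0 : 0 ≤ q := (mul_nonneg hγ.le hxx).trans (hVγ x)
  -- Cauchy–Schwarz twice: across the columns against v, and in the norm of V for each column.
  -- Summing over columns produces the factor n.
  have h1 : x ⬝ᵥ N *ᵥ v ≤ √q * (√(n * B) * √(v ⬝ᵥ v)) := by
    have e : x ⬝ᵥ N *ᵥ v = ∑ j, (x ⬝ᵥ N.col j) * v j := by
      simp only [dotProduct, mulVec, col, Finset.mul_sum, Finset.sum_mul, transpose_apply]
      rw [Finset.sum_comm]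
      exact Finset.sum_congr rfl fun i _ => Finset.sum_congr rfl fun j _ => by ring
    have hcs := Finset.sum_mul_sq_le_sq_mul_sq Finset.univ (fun j => x ⬝ᵥ N.col j) v
    have hs : ∑ j, (x ⬝ᵥ N.col j) ^ 2 ≤ q * (n * B) := by
      calc _ ≤ ∑ _j : Fin n, q * B := Finset.sum_le_sum fun j _ =>
            (sq_dotProduct_le hV x _).trans (mul_le_mul_of_nonneg_left (hN j) hq0)
        _ = _ := by simp; ring
    rw [← Real.sqrt_mul (by positivity), ← Real.sqrt_mul hq0, e]
    refine Real.le_sqrt_of_sq_le (hcs.trans ?_)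
    have hv2 : ∑ i, v i ^ 2 = v ⬝ᵥ v := by simp only [dotProduct, sq]
    rw [hv2, ← mul_assoc]
    exact mul_le_mul_of_nonneg_right hs hvv
  -- One factor γ is absorbed by γ |x|² ≤ q, so the regularisation bias costs only √γ.
  have h2 : -(γ * (x ⬝ᵥ θ *ᵥ v)) ≤ √q * (√γ * frobNorm θ * √(v ⬝ᵥ v)) := by
    have hcs := Finset.sum_mul_sq_le_sq_mul_sq Finset.univ x (θ *ᵥ v)
    have h3 : (x ⬝ᵥ θ *ᵥ v) ^ 2 ≤ (x ⬝ᵥ x) * (frobNorm θ ^ 2 * (v ⬝ᵥ v)) := by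
      refine le_trans ?_ (mul_le_mul_of_nonneg_left (dotProduct_mulVec_self_le θ v) hxx)
      simpa only [dotProduct, ← sq] using hcs
    refine (neg_le_abs _).trans (abs_le_of_sq_le_sq ?_ (by positivity))
    have : (√q * (√γ * frobNorm θ * √(v ⬝ᵥ v))) ^ 2 = q * (γ * (frobNorm θ ^ 2 * (v ⬝ᵥ v))) := by
      rw [mul_pow, mul_pow, mul_pow, Real.sq_sqrt hq0, Real.sq_sqrt hγ.le, Real.sq_sqrt hvv]
      ring
    rw [this]
    calc (γ * (x ⬝ᵥ θ *ᵥ v)) ^ 2 = γ ^ 2 * (x ⬝ᵥ θ *ᵥ v) ^ 2 := by ring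
      _ ≤ γ ^ 2 * ((x ⬝ᵥ x) * (frobNorm θ ^ 2 * (v ⬝ᵥ v))) := by gcongr
      _ = (γ * (x ⬝ᵥ x)) * (γ * (frobNorm θ ^ 2 * (v ⬝ᵥ v))) := by ring
      _ ≤ _ := mul_le_mul_of_nonneg_right (hVγ x) (by positivity)
  -- Since q = xᵀVx is the sum of the two inner products bounded above, a factor √q cancels.
  have h3 : √q ≤ (√γ * frobNorm θ + √(n * B)) * √(v ⬝ᵥ v) := by
    have e : q = x ⬝ᵥ N *ᵥ v - γ * (x ⬝ᵥ θ *ᵥ v) := by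
      rw [hq, hVx, dotProduct_sub, dotProduct_smul, smul_eq_mul]
    have h4 : √q * √q ≤ √q * ((√γ * frobNorm θ + √(n * B)) * √(v ⬝ᵥ v)) := by
      rw [Real.mul_self_sqrt hq0]
      nth_rewrite 1 [e]
      linarith
    rcases (Real.sqrt_nonneg q).eq_or_lt with h0 | h0
    · rw [← h0]; positivity
    · exact le_of_mul_le_mul_left h4 h0
  have h5 : l * (x ⬝ᵥ x) ≤ (√γ * frobNorm θ + √(n * B)) ^ 2 * (v ⬝ᵥ v) := by
    calc l * (x ⬝ᵥ x) ≤ q := hVl x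
      _ = √q ^ 2 := (Real.sq_sqrt hq0).symm
      _ ≤ ((√γ * frobNorm θ + √(n * B)) * √(v ⬝ᵥ v)) ^ 2 := by gcongr
      _ = _ := by rw [mul_pow, Real.sq_sqrt hvv]
  rw [mul_pow, div_pow, Real.sq_sqrt hl.le, one_pow, mul_assoc, one_div, ← div_eq_inv_mul,
    le_div_iff₀ hl]
  linarith

end LinearAlgebra

/-! ### Measurability of the closed loop and the normal equations -/

section Measurability

variable {β : Type*} [MeasurableSpace β] {d n : ℕ}

theorem measurable_param {A : β → Param d n} (h : ∀ i j, Measurable fun b => A b i j) :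
    Measurable A :=
  measurable_pi_lambda _ fun i => measurable_pi_lambda _ fun j => h i j

theorem measurable_param_apply {A : β → Param d n} (h : Measurable A) (i : Fin d) (j : Fin n) :
    Measurable fun b => A b i j :=
  (measurable_pi_apply j).comp ((measurable_pi_apply i).comp h)

theorem measurable_param_inv {A : β → Param d d} (h : Measurable A) :
    Measurable fun b => (A b)⁻¹ := by
  have hdet : Measurable fun b => (A b).det :=
    (Continuous.matrix_det continuous_id).measurable.comp h
  have hadj : Measurable fun b => (A b).adjugate :=
    (Continuous.matrix_adjugate continuous_id).measurable.comp h
  refine measurable_param fun i j => ?_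
  simp only [Matrix.inv_def, Ring.inverse_eq_inv', Matrix.smul_apply, smul_eq_mul]
  exact hdet.inv.mul (measurable_param_apply hadj i j)

theorem measurable_param_det {A : β → Param d d} (h : Measurable A) :
    Measurable fun b => (A b).det :=
  (Continuous.matrix_det continuous_id).measurable.comp h

end Measurability

theorem trMul_apply {d n : ℕ} (θ : Param d n) (z : E d) (j : Fin n) :
    trMul θ z j = ∑ i, θ i j * z i := by
  simp [trMul, Matrix.toLpLin_apply, Matrix.mulVec, dotProduct]

theorem trMul_add {d n : ℕ} (θ η : Param d n) (z : E d) :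
    trMul (θ + η) z = trMul θ z + trMul η z := by
  simp [trMul]

theorem trMul_smul {d n : ℕ} (c : ℝ) (η : Param d n) (z : E d) :
    trMul (c • η) z = c • trMul η z := by
  simp [trMul]

theorem continuous_trMul {d n : ℕ} (θ : Param d n) : Continuous (trMul θ) :=
  LinearMap.continuous_of_finiteDimensional _

namespace Model

variable {n m d q : ℕ} (M : Model n m d q)

/-- The regressor `ψ(x(s), u(s))` as a plain vector. -/
def regressor (h : ℕ → M.X × M.U) (s : ℕ) : Fin d → ℝ := (M.ψ (h s)).ofLp

/-- The response `x(s+1) - f(x(s), u(s))`. -/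
def response (h : ℕ → M.X × M.U) (s : ℕ) : Fin n → ℝ := ((h (s + 1)).1 - M.f (h s) : E n).ofLp

/-- The process noise `x(s+1) - f(x(s), u(s)) - θᵀ ψ(x(s), u(s))`. -/
def residual (h : ℕ → M.X × M.U) (s : ℕ) : Fin n → ℝ :=
  ((h (s + 1)).1 - M.predict (h s).1 (h s).2 : E n).ofLp

/-- The regularised Gramian. -/
def gram (h : ℕ → M.X × M.U) (t : ℕ) : Param d d :=
  M.γ • (1 : Matrix (Fin d) (Fin d) ℝ)
    + ∑ s ∈ Finset.range t, Matrix.vecMulVec (M.regressor h s) (M.regressor h s)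

/-- The right-hand side of the normal equations. -/
def responseSum (h : ℕ → M.X × M.U) (t : ℕ) : Param d n :=
  ∑ s ∈ Finset.range t, Matrix.vecMulVec (M.regressor h s) (M.response h s)

/-- The contribution of the process noise to the normal equations. -/
def noiseSum (h : ℕ → M.X × M.U) (t : ℕ) : Param d n :=
  ∑ s ∈ Finset.range t, Matrix.vecMulVec (M.regressor h s) (M.residual h s)

theorem dotProduct_gram_mulVec (h : ℕ → M.X × M.U) (t : ℕ) (x : Fin d → ℝ) :
    x ⬝ᵥ (M.gram h t).mulVec x = M.γ * (x ⬝ᵥ x)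
      + ∑ s ∈ Finset.range t, (x ⬝ᵥ M.regressor h s) ^ 2 := by
  rw [gram, Matrix.add_mulVec, dotProduct_add, Matrix.smul_mulVec, Matrix.one_mulVec,
    dotProduct_smul, smul_eq_mul, Matrix.sum_mulVec, dotProduct_sum]
  congr 1
  refine Finset.sum_congr rfl fun s _ => ?_
  rw [Matrix.vecMulVec_mulVec, dotProduct_smul, MulOpposite.smul_eq_mul_unop,
    MulOpposite.unop_op, dotProduct_comm (M.regressor h s), sq]

theorem gram_posDef (h : ℕ → M.X × M.U) (t : ℕ) : (M.gram h t).PosDef := by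
  refine Matrix.PosDef.of_dotProduct_mulVec_pos ?_ fun {x} hx => ?_
  · unfold gram Matrix.IsHermitian
    simp only [Matrix.conjTranspose_add, Matrix.conjTranspose_smul, Matrix.conjTranspose_one,
      Matrix.conjTranspose_sum, star_trivial, Matrix.conjTranspose_vecMulVec]
  · rw [star_trivial, dotProduct_gram_mulVec]
    have h1 : 0 < x ⬝ᵥ x := by simpa using Matrix.dotProduct_star_self_pos_iff.2 hx
    have := M.γ_pos
    positivity

theorem gram_succ (h : ℕ → M.X × M.U) (t : ℕ) : M.gram h (t + 1) =
    M.gram h t + Matrix.vecMulVec (M.regressor h t) (M.regressor h t) := by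
  rw [gram, Finset.sum_range_succ, ← add_assoc]; rfl

theorem noiseSum_succ_col (h : ℕ → M.X × M.U) (t : ℕ) (j : Fin n) :
    (M.noiseSum h (t + 1)).col j =
      (M.noiseSum h t).col j + M.residual h t j • M.regressor h t := by
  ext i
  simp [noiseSum, Finset.sum_range_succ, Matrix.col, Matrix.vecMulVec_apply, mul_comm]

/-- The cost is quadratic along every line; the linear coefficient in ε is its directional
derivative. -/
theorem rlsCost_add_smul (h : ℕ → M.X × M.U) (t : ℕ) (θ η : Param d n) (ε : ℝ) :
    M.rlsCost h t (θ + ε • η) = M.rlsCost h t θ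
      + 2 * ε * (M.γ * ∑ i, ∑ j, θ i j * η i j - ∑ s ∈ Finset.range t,
        ⟪((h (s + 1)).1 : E n) - trMul θ (M.ψ (h s)) - M.f (h s), trMul η (M.ψ (h s))⟫)
      + ε ^ 2 * (∑ s ∈ Finset.range t, ‖trMul η (M.ψ (h s))‖ ^ 2 + M.γ * frobNorm η ^ 2) := by
  unfold rlsCost frobNorm
  have h1 : ∀ s, ‖((h (s + 1)).1 : E n) - trMul (θ + ε • η) (M.ψ (h s)) - M.f (h s)‖ ^ 2 =
      ‖((h (s + 1)).1 : E n) - trMul θ (M.ψ (h s)) - M.f (h s)‖ ^ 2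
      - 2 * ε * ⟪((h (s + 1)).1 : E n) - trMul θ (M.ψ (h s)) - M.f (h s), trMul η (M.ψ (h s))⟫
      + ε ^ 2 * ‖trMul η (M.ψ (h s))‖ ^ 2 := by
    intro s
    rw [trMul_add, trMul_smul]
    have : ((h (s + 1)).1 : E n) - (trMul θ (M.ψ (h s)) + ε • trMul η (M.ψ (h s))) - M.f (h s) =
      (((h (s + 1)).1 : E n) - trMul θ (M.ψ (h s)) - M.f (h s)) - ε • trMul η (M.ψ (h s)) := by
      abel
    rw [this, norm_sub_sq_real, inner_smul_right, norm_smul, mul_pow, Real.norm_eq_abs, sq_abs]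
    ring
  rw [Finset.sum_congr rfl fun s _ => h1 s, Real.sq_sqrt (by positivity),
    Real.sq_sqrt (by positivity), Real.sq_sqrt (by positivity)]
  simp only [Finset.sum_add_distrib, Finset.sum_sub_distrib, ← Finset.mul_sum, Matrix.add_apply,
    Matrix.smul_apply, smul_eq_mul]
  have h2 : ∑ i, ∑ j, (θ i j + ε * η i j) ^ 2 = ∑ i, ∑ j, θ i j ^ 2
      + 2 * ε * ∑ i, ∑ j, θ i j * η i j + ε ^ 2 * ∑ i, ∑ j, η i j ^ 2 := by
    simp only [Finset.mul_sum, ← Finset.sum_add_distrib]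
    exact Finset.sum_congr rfl fun i _ => Finset.sum_congr rfl fun j _ => by ring
  rw [h2]
  ring

/-- First-order optimality, tested along each matrix unit to read off one entry of the normal
equations. -/
theorem gram_mul_rls (h : ℕ → M.X × M.U) {t : ℕ} (ht : t ≠ 0) :
    M.gram h t * M.rls h t = M.responseSum h t := by
  set θ := M.rls h t with hθ
  ext i j
  set η : Param d n := Matrix.single i j 1 with hη
  set L := M.γ * ∑ i, ∑ j, θ i j * η i j - ∑ s ∈ Finset.range t,
        ⟪((h (s + 1)).1 : E n) - trMul θ (M.ψ (h s)) - M.f (h s), trMul η (M.ψ (h s))⟫ with hL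
  have hL0 : L = 0 := by
    -- A quadratic without constant term that is nonnegative everywhere has no linear term, by its
    -- discriminant.
    have hq : ∀ ε : ℝ, 0 ≤ (∑ s ∈ Finset.range t, ‖trMul η (M.ψ (h s))‖ ^ 2
        + M.γ * frobNorm η ^ 2) * (ε * ε) + (2 * L) * ε + 0 := by
      intro ε
      have := M.rls_isMin h ht (θ + ε • η)
      rw [rlsCost_add_smul] at this
      linarith
    have := discrim_le_zero hq
    unfold discrim at this
    nlinarith
  have h1 : ∑ a, ∑ b, θ a b * η a b = θ i j := by
    rw [Finset.sum_eq_single i, Finset.sum_eq_single j] <;>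
      simp +contextual [hη, Matrix.single_apply, eq_comm]
  have h2 : ∀ s, trMul η (M.ψ (h s)) = EuclideanSpace.single j (M.ψ (h s) i) := by
    intro s
    ext b
    rw [trMul_apply, Finset.sum_eq_single i]
    · simp [hη, Matrix.single_apply, eq_comm]
    · simp +contextual [hη, eq_comm]
    · simp
  rw [hL, h1] at hL0
  simp only [h2, EuclideanSpace.inner_single_right] at hL0
  simp only [gram, responseSum, Matrix.add_mul, Matrix.smul_mul, Matrix.one_mul, Matrix.add_apply,
    Matrix.smul_apply, smul_eq_mul, Matrix.sum_mul, Matrix.sum_apply, Matrix.vecMulVec_apply,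
    Matrix.vecMulVec_mul]
  have h3 : ∑ s ∈ Finset.range t, M.ψ (h s) i * (starRingEnd ℝ)
      ((((h (s + 1)).1 : E n) - trMul θ (M.ψ (h s)) - M.f (h s)) j) =
      ∑ s ∈ Finset.range t, M.regressor h s i * M.response h s j
        - ∑ s ∈ Finset.range t, M.regressor h s i * Matrix.vecMul (M.regressor h s) θ j := by
    rw [← Finset.sum_sub_distrib]
    refine Finset.sum_congr rfl fun s _ => ?_
    have : Matrix.vecMul (M.regressor h s) θ j = trMul θ (M.ψ (h s)) j := by
      rw [trMul_apply]
      change ∑ a, M.regressor h s a * θ a j = _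
      exact Finset.sum_congr rfl fun a _ => mul_comm (M.regressor h s a) (θ a j)
    rw [this]
    simp only [regressor, response, PiLp.sub_apply, conj_trivial]
    ring
  rw [h3] at hL0
  linarith

theorem response_eq (h : ℕ → M.X × M.U) (s : ℕ) :
    M.response h s = M.residual h s + (M.θ.transpose).mulVec (M.regressor h s) := by
  ext j
  simp [response, residual, regressor, predict, trMul, Matrix.toLpLin_apply]
  ring

theorem gram_mul_rls_sub (h : ℕ → M.X × M.U) {t : ℕ} (ht : t ≠ 0) :
    M.gram h t * (M.rls h t - M.θ) = M.noiseSum h t - M.γ • M.θ := by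
  rw [Matrix.mul_sub, gram_mul_rls M h ht, gram, Matrix.add_mul, Matrix.smul_mul, Matrix.one_mul,
    sub_add_eq_sub_sub_swap]
  congr 1
  rw [responseSum, noiseSum, Matrix.sum_mul, ← Finset.sum_sub_distrib]
  refine Finset.sum_congr rfl fun s _ => ?_
  rw [response_eq, Matrix.vecMulVec_add, Matrix.vecMulVec_mul, Matrix.mulVec_transpose,
    add_sub_cancel_right]

/-- The estimate is defined by choice; this closed form is what makes it measurable. -/
theorem rls_eq_inv_mul (h : ℕ → M.X × M.U) {t : ℕ} (ht : t ≠ 0) :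
    M.rls h t = (M.gram h t)⁻¹ * M.responseSum h t := by
  rw [← gram_mul_rls M h ht, ← Matrix.mul_assoc,
    Matrix.nonsing_inv_mul _ (PosDef.isUnit_det (M.gram_posDef h t)), Matrix.one_mul]

variable {M}

theorem measurable_predict (hM : MeasurableMaps M) :
    Measurable fun a : M.X × M.U => M.predict a.1 a.2 :=
  hM.f.add ((continuous_trMul M.θ).measurable.comp hM.ψ)

theorem measurable_regressor (hM : MeasurableMaps M) (s : ℕ) (i : Fin d) :
    Measurable fun h => M.regressor h s i := by
  have : Measurable fun h : ℕ → M.X × M.U => M.ψ (h s) := hM.ψ.comp (measurable_pi_apply s)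
  unfold regressor
  fun_prop

theorem measurable_response (hM : MeasurableMaps M) (s : ℕ) (j : Fin n) :
    Measurable fun h => M.response h s j := by
  have : Measurable fun h : ℕ → M.X × M.U => M.f (h s) := hM.f.comp (measurable_pi_apply s)
  unfold response
  fun_prop

theorem measurable_residual (hM : MeasurableMaps M) (s : ℕ) (j : Fin n) :
    Measurable fun h => M.residual h s j := by
  have : Measurable fun h : ℕ → M.X × M.U => M.predict (h s).1 (h s).2 :=
    (measurable_predict hM).comp (measurable_pi_apply s)
  unfold residual
  fun_prop

theorem measurable_gram (hM : MeasurableMaps M) (t : ℕ) : Measurable fun h => M.gram h t := by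
  refine measurable_param fun i j => ?_
  simp only [gram, Matrix.add_apply, Matrix.sum_apply, Matrix.vecMulVec_apply]
  have := measurable_regressor hM
  fun_prop

theorem measurable_responseSum (hM : MeasurableMaps M) (t : ℕ) :
    Measurable fun h => M.responseSum h t := by
  refine measurable_param fun i j => ?_
  simp only [responseSum, Matrix.sum_apply, Matrix.vecMulVec_apply]
  have := measurable_regressor hM
  have := measurable_response hM
  fun_prop

theorem measurable_noiseSum (hM : MeasurableMaps M) (t : ℕ) :
    Measurable fun h => M.noiseSum h t := by
  refine measurable_param fun i j => ?_
  simp only [noiseSum, Matrix.sum_apply, Matrix.vecMulVec_apply]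
  have := measurable_regressor hM
  have := measurable_residual hM
  fun_prop

theorem measurable_rls (hM : MeasurableMaps M) (t : ℕ) : Measurable fun h => M.rls h t := by
  by_cases ht : t = 0
  · simp only [rls, ht, if_true]
    exact measurable_const
  · simp only [fun h => M.rls_eq_inv_mul h ht]
    refine measurable_param fun i j => ?_
    simp only [Matrix.mul_apply]
    have h1 := fun k => measurable_param_apply (measurable_param_inv (measurable_gram hM t)) i k
    have h2 := fun k => measurable_param_apply (measurable_responseSum hM t) k j
    exact Finset.measurable_fun_sum _ fun k _ => (h1 k).mul (h2 k)

variable (M)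

/-- One step of the closed loop as a map of the history up to time `t` and of the noise. -/
def advance (t : ℕ) (a : (ℕ → M.X × M.U) × (M.W × M.S)) : ℕ → M.X × M.U :=
  Function.update a.1 (t + 1) (M.step (a.1 t).1 (a.1 t).2 a.2.1,
    M.α (M.step (a.1 t).1 (a.1 t).2 a.2.1, a.2.2, M.rls a.1 t))

theorem history_succ (x₀ : M.X) (w : ℕ → M.W) (s : ℕ → M.S) (t : ℕ) :
    M.history x₀ w s (t + 1) = M.advance t (M.history x₀ w s t, (w (t + 1), s (t + 1))) := rfl

theorem advance_of_le (t i : ℕ) (hi : i ≤ t) (a : (ℕ → M.X × M.U) × (M.W × M.S)) :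
    M.advance t a i = a.1 i :=
  Function.update_of_ne (by omega) _ _

theorem advance_succ (t : ℕ) (a : (ℕ → M.X × M.U) × (M.W × M.S)) :
    M.advance t a (t + 1) = (M.step (a.1 t).1 (a.1 t).2 a.2.1,
      M.α (M.step (a.1 t).1 (a.1 t).2 a.2.1, a.2.2, M.rls a.1 t)) :=
  Function.update_self _ _ _

variable {M}

theorem measurable_advance (hM : MeasurableMaps M) (t : ℕ) : Measurable (M.advance t) := by
  have hstep : Measurable fun a : (ℕ → M.X × M.U) × (M.W × M.S) =>
      M.step (a.1 t).1 (a.1 t).2 a.2.1 := by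
    refine Measurable.subtype_mk ?_
    exact ((measurable_predict hM).comp ((measurable_pi_apply t).comp measurable_fst)).add
      (measurable_subtype_coe.comp (measurable_fst.comp measurable_snd))
  have hα : Measurable fun a : (ℕ → M.X × M.U) × (M.W × M.S) =>
      M.α (M.step (a.1 t).1 (a.1 t).2 a.2.1, a.2.2, M.rls a.1 t) :=
    hM.α.comp (hstep.prodMk ((measurable_snd.comp measurable_snd).prodMk
      ((measurable_rls hM t).comp measurable_fst)))
  refine measurable_pi_lambda _ fun i => ?_
  by_cases hi : i = t + 1
  · subst hi
    simp only [advance_succ]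
    exact hstep.prodMk hα
  · simp only [advance, Function.update_of_ne hi]
    fun_prop

/-- The history up to time t factors measurably through W(1), …, W(t) and S(0), …, S(t), so
independence from later noise reduces to independence of finite families. -/
theorem exists_measurable_history (hM : MeasurableMaps M) (x₀ : M.X) (t : ℕ) :
    ∃ H : (Finset.range t → M.W) × (Finset.range (t + 1) → M.S) → ℕ → M.X × M.U, Measurable H ∧
      ∀ w s, M.history x₀ w s t = H (fun i => w (i + 1), fun i => s i) := by
  induction t with
  | zero =>
    have h0 : 0 ∈ Finset.range (0 + 1) := by simp
    refine ⟨fun a _ => (x₀, M.α (x₀, a.2 ⟨0, h0⟩, M.ϑ₀)), ?_, fun w s => rfl⟩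
    refine measurable_pi_lambda _ fun _ => measurable_const.prodMk (hM.α.comp ?_)
    fun_prop
  | succ t ih =>
    obtain ⟨H, hH, hHe⟩ := ih
    have h1 : t ∈ Finset.range (t + 1) := by simp
    have h2 : t + 1 ∈ Finset.range (t + 1 + 1) := by simp
    have h3 : ∀ i : Finset.range t, (i : ℕ) ∈ Finset.range (t + 1) := fun i => by
      have := Finset.mem_range.1 i.2
      exact Finset.mem_range.2 (by omega)
    have h4 : ∀ i : Finset.range (t + 1), (i : ℕ) ∈ Finset.range (t + 1 + 1) := fun i => by
      have := Finset.mem_range.1 i.2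
      exact Finset.mem_range.2 (by omega)
    refine ⟨fun a => M.advance t (H (fun i => a.1 ⟨i, h3 i⟩, fun i => a.2 ⟨i, h4 i⟩),
      (a.1 ⟨t, h1⟩, a.2 ⟨t + 1, h2⟩)), ?_, fun w s => ?_⟩
    · refine (measurable_advance hM t).comp ((hH.comp ?_).prodMk ?_) <;> fun_prop
    · rw [history_succ, hHe]

end Model

/-! ### Independence of the fresh noise and Ville's inequality along the closed loop -/

section Noise

variable {n m d q : ℕ} {M : Model n m d q} {Ω : Type*} [MeasurableSpace Ω] {P : Measure Ω}
  {W : ℕ → Ω → M.W} {S : ℕ → Ω → M.S} {μw : Measure M.W} {μs : Measure M.S} {σw : ℝ≥0}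

/-- The closed-loop history as a random variable. -/
def historyAt (M : Model n m d q) (W : ℕ → Ω → M.W) (S : ℕ → Ω → M.S) (x₀ : M.X) (t : ℕ) (ω : Ω) :
    ℕ → M.X × M.U :=
  M.history x₀ (fun i => W i ω) (fun i => S i ω) t

theorem NoiseAssumption.measurable_historyAt (hM : MeasurableMaps M)
    (hN : NoiseAssumption M P W S μw μs σw) (x₀ : M.X) (t : ℕ) :
    Measurable (historyAt M W S x₀ t) := by
  obtain ⟨H, hH, hHe⟩ := Model.exists_measurable_history hM x₀ t
  have h1 := hN.measurable_W
  have h2 := hN.measurable_S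
  unfold historyAt
  simp only [hHe]
  exact hH.comp (by fun_prop)

theorem NoiseAssumption.indepFun_historyAt [IsProbabilityMeasure P] (hM : MeasurableMaps M)
    (hN : NoiseAssumption M P W S μw μs σw) (x₀ : M.X) (t : ℕ) :
    IndepFun (historyAt M W S x₀ t) (fun ω => (W (t + 1) ω, S (t + 1) ω)) P := by
  obtain ⟨H, hH, hHe⟩ := Model.exists_measurable_history hM x₀ t
  have h1 := hN.measurable_W
  have h2 := hN.measurable_S
  have hAB : IndepFun (fun ω (i : Finset.range t) => W (i + 1) ω) (W (t + 1)) P :=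
    (hN.indep_W.indepFun_finset (Finset.range t) {t} (by simp) h1).comp measurable_id
      (measurable_pi_apply (⟨t, by simp⟩ : ({t} : Finset ℕ)))
  have hCD : IndepFun (fun ω (i : Finset.range (t + 1)) => S i ω) (S (t + 1)) P :=
    (hN.indep_S.indepFun_finset (Finset.range (t + 1)) {t + 1} (by simp) h2).comp measurable_id
      (measurable_pi_apply (⟨t + 1, by simp⟩ : ({t + 1} : Finset ℕ)))
  have h : IndepFun (fun ω => ((fun i : Finset.range t => W (i + 1) ω), W (t + 1) ω))
      (fun ω => ((fun i : Finset.range (t + 1) => S i ω), S (t + 1) ω)) P :=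
    hN.indep_W_S.comp
      (φ := fun w : ℕ → M.W => ((fun i : Finset.range t => w i), w t))
      (ψ := fun s : ℕ → M.S => ((fun i : Finset.range (t + 1) => s i), s (t + 1)))
      (by fun_prop) (by fun_prop)
  have := indepFun_prodMk_prodMk (by fun_prop) (h1 t) (by fun_prop) (h2 (t + 1)) hAB hCD h
  have := this.comp hH measurable_id
  unfold historyAt
  simp only [hHe]
  exact this

theorem NoiseAssumption.map_prodMk [IsProbabilityMeasure P]
    (hN : NoiseAssumption M P W S μw μs σw) (t : ℕ) :
    P.map (fun ω => (W (t + 1) ω, S (t + 1) ω)) = μw.prod μs := by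
  have : IndepFun (W (t + 1)) (S (t + 1)) P :=
    hN.indep_W_S.comp (measurable_pi_apply t) (measurable_pi_apply (t + 1))
  rw [(indepFun_iff_map_prod_eq_prod_map_map (hN.measurable_W t).aemeasurable
    (hN.measurable_S (t + 1)).aemeasurable).1 this, hN.law_W, hN.law_S]

/-- Ville's inequality along the closed loop. -/
theorem NoiseAssumption.measure_exists_le [IsProbabilityMeasure P] (hM : MeasurableMaps M)
    (hN : NoiseAssumption M P W S μw μs σw) (x₀ : M.X)
    {K : ℕ → (ℕ → M.X × M.U) → ℝ≥0∞} (hK : ∀ t, Measurable (K t)) (hK0 : ∀ y, K 0 y ≤ 1)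
    (hKcongr : ∀ t (h h' : ℕ → M.X × M.U), (∀ i ≤ t, h i = h' i) → K t h = K t h')
    (hstep : ∀ t h, ∫⁻ z, K (t + 1) (M.advance t (h, z)) ∂(μw.prod μs) ≤ K t h)
    {a : ℝ≥0∞} (ha : a ≠ 0) (ha' : a ≠ ⊤) :
    P {ω | ∃ t, a ≤ K t (M.traj x₀ (fun i => W i ω) (fun i => S i ω))} ≤ a⁻¹ := by
  -- The padded history, which obeys a recursion, may replace the trajectory because `K t` sees only
  -- times up to t.
  have hset : {ω | ∃ t, a ≤ K t (M.traj x₀ (fun i => W i ω) (fun i => S i ω))} =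
      {ω | ∃ t, a ≤ K t (historyAt M W S x₀ t ω)} := by
    ext ω
    refine exists_congr fun t => ?_
    rw [hKcongr t (historyAt M W S x₀ t ω) _ fun i hi => M.history_eq x₀ _ _ t i hi]
  rw [hset]
  refine measure_exists_le_of_supermartingale (hN.measurable_historyAt hM x₀)
    (ξ := fun t ω => (W (t + 1) ω, S (t + 1) ω))
    (fun t => (hN.measurable_W t).prodMk (hN.measurable_S (t + 1)))
    (Model.measurable_advance hM) (fun t ω => rfl) (hN.indepFun_historyAt hM x₀) hK hK0
    (fun t i hi y z => hKcongr i _ _ fun k hk => M.advance_of_le t k (hk.trans hi) _)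
    (fun t h => ?_) ha ha'
  rw [hN.map_prodMk]
  exact hstep t h

end Noise

/-! ### Locality of the functionals of the history -/

namespace Model

variable {n m d q : ℕ} (M : Model n m d q)

theorem regressor_congr {h h' : ℕ → M.X × M.U} {s : ℕ} (hs : h s = h' s) :
    M.regressor h s = M.regressor h' s := by
  rw [regressor, hs]; rfl

theorem gram_congr {h h' : ℕ → M.X × M.U} {t : ℕ} (hh : ∀ i < t, h i = h' i) :
    M.gram h t = M.gram h' t := by
  unfold gram
  congr 1
  refine Finset.sum_congr rfl fun s hs => ?_
  rw [M.regressor_congr (hh s (Finset.mem_range.1 hs))]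

theorem noiseSum_congr {h h' : ℕ → M.X × M.U} {t : ℕ} (hh : ∀ i ≤ t, h i = h' i) :
    M.noiseSum h t = M.noiseSum h' t := by
  unfold noiseSum
  refine Finset.sum_congr rfl fun s hs => ?_
  have := Finset.mem_range.1 hs
  rw [M.regressor_congr (hh s (by omega)), residual, hh s (by omega), hh (s + 1) (by omega)]
  rfl

theorem residual_advance (h : ℕ → M.X × M.U) (t : ℕ) (z : M.W × M.S) :
    M.residual (M.advance t (h, z)) t = (z.1 : E n).ofLp := by
  rw [residual, advance_succ, advance_of_le _ _ _ le_rfl]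
  simp [step]

/-- The squared self-normalised norm of the `j`-th column of the noise term. -/
def selfNorm (j : Fin n) (t : ℕ) (h : ℕ → M.X × M.U) : ℝ :=
  (M.noiseSum h t).col j ⬝ᵥ (M.gram h t)⁻¹.mulVec ((M.noiseSum h t).col j)

/-- The self-normalised supermartingale. -/
def selfNormMart (σ : ℝ) (j : Fin n) (t : ℕ) (h : ℕ → M.X × M.U) : ℝ :=
  (√((M.gram h t).det / M.γ ^ d))⁻¹ * Real.exp (M.selfNorm j t h / (2 * σ ^ 2))

theorem selfNormMart_zero (σ : ℝ) (j : Fin n) (h : ℕ → M.X × M.U) : M.selfNormMart σ j 0 h = 1 := by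
  have := M.γ_pos
  have h0 : (M.noiseSum h 0).col j = 0 := by ext; simp [noiseSum, Matrix.col]
  simp [selfNormMart, selfNorm, h0, gram, this.ne']

theorem selfNormMart_congr (σ : ℝ) (j : Fin n) {t : ℕ} {h h' : ℕ → M.X × M.U}
    (hh : ∀ i ≤ t, h i = h' i) : M.selfNormMart σ j t h = M.selfNormMart σ j t h' := by
  rw [selfNormMart, selfNormMart, selfNorm, selfNorm, M.gram_congr fun i hi => hh i hi.le,
    M.noiseSum_congr hh]

/-- The multiplier is the integrand of `lintegral_exp_quadratic_le`, with a = uᵀV⁻¹u and b =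
uᵀV⁻¹x/σ fixed by the past: the determinant lemma gives the root and the rank-one update of the
quadratic form gives the exponent. -/
theorem selfNormMart_advance {σ : ℝ} (hσ : σ ≠ 0) (j : Fin n) (t : ℕ) (h : ℕ → M.X × M.U) :
    ∃ a b : ℝ, 0 ≤ a ∧ ∀ z, M.selfNormMart σ j (t + 1) (M.advance t (h, z)) =
      M.selfNormMart σ j t h * ((√(1 + a))⁻¹ * Real.exp ((2 * b * ((z.1 : E n) j / σ)
        + a * ((z.1 : E n) j / σ) ^ 2 - b ^ 2) / (2 * (1 + a)))) := by
  set V := M.gram h t with hV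
  set u := M.regressor h t with hu
  set x := (M.noiseSum h t).col j with hx
  have hpd := M.gram_posDef h t
  have ha : 0 ≤ u ⬝ᵥ V⁻¹.mulVec u := PosDef.dotProduct_inv_nonneg hpd u
  refine ⟨u ⬝ᵥ V⁻¹.mulVec u, (u ⬝ᵥ V⁻¹.mulVec x) / σ, ha, fun z => ?_⟩
  have hadv : ∀ i ≤ t, M.advance t (h, z) i = h i := fun i hi => M.advance_of_le t i hi _
  rw [selfNormMart, selfNorm, M.gram_succ, M.noiseSum_succ_col, M.gram_congr fun i hi => hadv i hi.le,
    M.noiseSum_congr hadv, M.regressor_congr (hadv t le_rfl), residual_advance, ← hV, ← hu, ← hx,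
    det_add_vecMulVec hpd, dotProduct_inv_add_vecMulVec hpd, selfNormMart, selfNorm, ← hV, ← hx]
  set a := u ⬝ᵥ V⁻¹.mulVec u
  set b := u ⬝ᵥ V⁻¹.mulVec x
  rw [mul_div_right_comm, Real.sqrt_mul (div_nonneg hpd.det_pos.le (pow_nonneg M.γ_pos.le _)), mul_inv]
  rw [add_div, Real.exp_add]
  have : (2 * b * (z.1 : E n) j + a * (z.1 : E n) j ^ 2 - b ^ 2) / (1 + a) / (2 * σ ^ 2) =
    (2 * (b / σ) * ((z.1 : E n) j / σ) + a * ((z.1 : E n) j / σ) ^ 2 - (b / σ) ^ 2)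
      / (2 * (1 + a)) := by
    field_simp
  rw [this]
  ring

variable {M}

theorem measurable_selfNormMart (hM : MeasurableMaps M) (σ : ℝ) (j : Fin n) (t : ℕ) :
    Measurable (M.selfNormMart σ j t) := by
  have h1 := measurable_gram hM t
  have h2 := fun i => measurable_param_apply (measurable_noiseSum hM t) i j
  have h3 := fun i k => measurable_param_apply (measurable_param_inv h1) i k
  have h4 := measurable_param_det h1
  refine ((h4.div_const (M.γ ^ d)).sqrt.inv).mul
    (Real.measurable_exp.comp (Measurable.div_const ?_ _))
  change Measurable fun h => ∑ i, M.noiseSum h t i j *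
    ∑ k, (M.gram h t)⁻¹ i k * M.noiseSum h t k j
  exact Finset.measurable_fun_sum _ fun i _ =>
    (h2 i).mul (Finset.measurable_fun_sum _ fun k _ => (h3 i k).mul (h2 k))

end Model

/-- The Basel sum; these weights distribute a failure probability over time in the noise and the
excitation union bounds. -/
theorem tsum_ofReal_inv_sq {η : ℝ} (hη : 0 ≤ η) :
    ∑' t : ℕ, ENNReal.ofReal (6 * η / (Real.pi ^ 2 * ((t : ℝ) + 1) ^ 2)) = ENNReal.ofReal η := by
  have h1 : HasSum (fun t : ℕ => 1 / ((t : ℝ) + 1) ^ 2) (Real.pi ^ 2 / 6) := by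
    have := (hasSum_nat_add_iff' 1).2 hasSum_zeta_two
    simpa using this
  have h2 : HasSum (fun t : ℕ => 6 * η / (Real.pi ^ 2 * ((t : ℝ) + 1) ^ 2)) η := by
    have hπ := Real.pi_ne_zero
    have h3 := h1.mul_left (6 * η / Real.pi ^ 2)
    rw [show 6 * η / Real.pi ^ 2 * (Real.pi ^ 2 / 6) = η by field_simp] at h3
    refine h3.congr_fun fun t => ?_
    field_simp
  rw [← ENNReal.ofReal_tsum_of_nonneg (fun t => by positivity) h2.summable, h2.tsum_eq]

/-! ### Probability of the noise and self-normalisation events -/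

section Events

variable {n m d q : ℕ} {M : Model n m d q} {Ω : Type*} [MeasurableSpace Ω] {P : Measure Ω}
  {W : ℕ → Ω → M.W} {S : ℕ → Ω → M.S} {μw : Measure M.W} {μs : Measure M.S} {σw : ℝ≥0}

theorem NoiseAssumption.coord (hN : NoiseAssumption M P W S μw μs σw) (t : ℕ) (j : Fin n) :
    HasSubgaussianMGF (fun ω => (W (t + 1) ω : E n) j) (σw ^ 2) P := by
  have := hN.subGaussian t (EuclideanSpace.single j 1) (by simp)
  simpa [EuclideanSpace.inner_single_left] using this

variable [IsProbabilityMeasure P]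

theorem NoiseAssumption.lintegral_exp_le (hN : NoiseAssumption M P W S μw μs σw) (hσ : σw ≠ 0)
    (j : Fin n) (l : ℝ) :
    ∫⁻ z, ENNReal.ofReal (Real.exp (l * ((z.1 : E n) j / σw) - l ^ 2 / 2)) ∂(μw.prod μs) ≤ 1 := by
  have hσ' : (σw : ℝ) ≠ 0 := by exact_mod_cast hσ
  have h1 := hN.measurable_W 0
  have h2 := hN.measurable_S 1
  rw [← hN.map_prodMk 0, lintegral_map (by fun_prop) (by fun_prop)]
  have hsub := hN.coord 0 j
  have hint := hsub.integrable_exp_mul (l / σw)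
  have hle := hsub.mgf_le (l / σw)
  have e : ∀ ω, ENNReal.ofReal (Real.exp (l * ((W (0 + 1) ω : E n) j / σw) - l ^ 2 / 2)) =
      ENNReal.ofReal (Real.exp (l / σw * (W (0 + 1) ω : E n) j)) *
        ENNReal.ofReal (Real.exp (-(l ^ 2 / 2))) := by
    intro ω
    rw [← ENNReal.ofReal_mul (Real.exp_nonneg _), ← Real.exp_add]
    congr 2
    ring
  simp only [e]
  rw [lintegral_mul_const _ (by fun_prop),
    ← ofReal_integral_eq_lintegral_ofReal hint (ae_of_all _ fun _ => Real.exp_nonneg _),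
    ← ENNReal.ofReal_mul (integral_nonneg fun _ => Real.exp_nonneg _)]
  refine ENNReal.ofReal_le_one.2 ?_
  rw [mgf] at hle
  calc _ ≤ Real.exp (((σw ^ 2 : ℝ≥0) : ℝ) * (l / σw) ^ 2 / 2) * Real.exp (-(l ^ 2 / 2)) := by gcongr
    _ = 1 := by
      rw [← Real.exp_add, Real.exp_eq_one_iff]
      push_cast
      field_simp
      ring

/-- The self-normalised bound on one column of the noise term, uniformly in time. -/
theorem NoiseAssumption.measure_selfNorm_gt (hM : MeasurableMaps M)
    (hN : NoiseAssumption M P W S μw μs σw) (hσ : σw ≠ 0) (x₀ : M.X) (j : Fin n) {η : ℝ}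
    (hη : 0 < η) :
    P {ω | ∃ t, 2 * (σw : ℝ) ^ 2 * (Real.log (1 / η) + 1 / 2 * Real.log
      ((M.gram (M.traj x₀ (fun i => W i ω) (fun i => S i ω)) t).det / M.γ ^ d))
      < M.selfNorm j t (M.traj x₀ (fun i => W i ω) (fun i => S i ω))} ≤ ENNReal.ofReal η := by
  have hσ' : (σw : ℝ) ≠ 0 := by exact_mod_cast hσ
  have := Measure.isProbabilityMeasure_map (μ := P)
    ((hN.measurable_W 0).prodMk (hN.measurable_S 1)).aemeasurable
  rw [hN.map_prodMk 0] at this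
  have key := hN.measure_exists_le hM x₀ (K := fun t h => ENNReal.ofReal (M.selfNormMart σw j t h))
    (fun t => (Model.measurable_selfNormMart hM σw j t).ennreal_ofReal)
    (fun h => by simp [M.selfNormMart_zero])
    (fun t h h' hh => by simp only [M.selfNormMart_congr _ _ hh]) (fun t h => ?_)
    (a := ENNReal.ofReal (1 / η)) (by simpa using hη) ENNReal.ofReal_ne_top
  · have e : (ENNReal.ofReal (1 / η))⁻¹ = ENNReal.ofReal η := by
      rw [← ENNReal.ofReal_inv_of_pos (by positivity), one_div, inv_inv]
    rw [e] at key
    refine (measure_mono ?_).trans key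
    rintro ω ⟨t, ht⟩
    refine ⟨t, ENNReal.ofReal_le_ofReal ?_⟩
    set h := M.traj x₀ (fun i => W i ω) (fun i => S i ω)
    have hdet : 0 < (M.gram h t).det / M.γ ^ d :=
      div_pos (M.gram_posDef h t).det_pos (pow_pos M.γ_pos d)
    have hlt : Real.log (1 / η) + 1 / 2 * Real.log ((M.gram h t).det / M.γ ^ d) ≤
        M.selfNorm j t h / (2 * (σw : ℝ) ^ 2) := by
      rw [le_div_iff₀ (by positivity)]
      linarith
    rw [Model.selfNormMart, ← div_eq_inv_mul, le_div_iff₀ (by positivity)]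
    calc 1 / η * √((M.gram h t).det / M.γ ^ d) = Real.exp (Real.log (1 / η)
          + 1 / 2 * Real.log ((M.gram h t).det / M.γ ^ d)) := by
          rw [Real.exp_add, Real.exp_log (by positivity), Real.sqrt_eq_rpow,
            Real.rpow_def_of_pos hdet, mul_comm (1 / 2 : ℝ)]
      _ ≤ _ := Real.exp_le_exp.2 hlt
  -- The supermartingale step: the past value factors out and the remaining mean is at most one.
  · obtain ⟨a, b, ha, hab⟩ := M.selfNormMart_advance hσ' j t h
    have h0 : 0 ≤ M.selfNormMart σw j t h := by unfold Model.selfNormMart; positivity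
    simp only [hab, ENNReal.ofReal_mul h0]
    rw [lintegral_const_mul _ (by fun_prop)]
    calc _ ≤ ENNReal.ofReal (M.selfNormMart σw j t h) * 1 := by
          gcongr
          exact lintegral_exp_quadratic_le (X := fun z : M.W × M.S => (z.1 : E n) j / σw)
            (by fun_prop) (hN.lintegral_exp_le hσ j) ha b
      _ = _ := mul_one _

theorem NoiseAssumption.measure_abs_coord_ge (hN : NoiseAssumption M P W S μw μs σw)
    (t : ℕ) (j : Fin n) {r : ℝ} (hr : 0 ≤ r) :
    P {ω | r ≤ |(W (t + 1) ω : E n) j|} ≤ ENNReal.ofReal (2 * Real.exp (-r ^ 2 / (2 * σw ^ 2))) := by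
  have h1 := (hN.coord t j).measure_ge_le hr
  have h2 := (hN.coord t j).neg.measure_ge_le hr
  have hsub : {ω | r ≤ |(W (t + 1) ω : E n) j|} ⊆
      {ω | r ≤ (W (t + 1) ω : E n) j} ∪ {ω | r ≤ (-fun ω => (W (t + 1) ω : E n) j) ω} := by
    intro ω hω
    exact (le_abs (a := r) (b := (W (t + 1) ω : E n) j)).1 hω
  refine (measure_mono hsub).trans ((measure_union_le _ _).trans ?_)
  push_cast at h1 h2
  rw [two_mul, ENNReal.ofReal_add (Real.exp_nonneg _) (Real.exp_nonneg _)]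
  exact add_le_add ((ENNReal.le_ofReal_iff_toReal_le (measure_ne_top _ _) (Real.exp_nonneg _)).2 h1)
    ((ENNReal.le_ofReal_iff_toReal_le (measure_ne_top _ _) (Real.exp_nonneg _)).2 h2)

/-- A norm above w̄ = √n · r forces some coordinate to reach r in absolute value. With r = σ√(2 ln
y) each coordinate contributes 2/y, and y = nπ²t²/(3η) makes the n contributions add up to the Basel
weight. -/
theorem NoiseAssumption.measure_norm_gt_wBar (hn : 0 < n) (hN : NoiseAssumption M P W S μw μs σw)
    {η : ℝ} (hη : η ∈ Set.Ioo (0 : ℝ) 1) (t : ℕ) :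
    P {ω | wBar n σw (t + 1) η < ‖(W (t + 1) ω : E n)‖₊} ≤
      ENNReal.ofReal (6 * η / (Real.pi ^ 2 * ((t : ℝ) + 1) ^ 2)) := by
  have hη0 := hη.1
  by_cases hσ : σw = 0
  -- For σ = 0 the threshold is zero and the tail exponent degenerates, but then the noise vanishes
  -- almost surely.
  · have hz : ∀ᵐ ω ∂P, ∀ j, (W (t + 1) ω : E n) j = 0 := by
      refine ae_all_iff.2 fun j => ?_
      have := hN.coord t j
      rw [hσ, zero_pow two_ne_zero] at this
      exact this.ae_eq_zero_of_hasSubgaussianMGF_zero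
    have h0 : P {ω | wBar n σw (t + 1) η < ‖(W (t + 1) ω : E n)‖₊} = 0 := by
      refine measure_mono_null ?_ hz
      intro ω hω hcon
      have : (W (t + 1) ω : E n) = 0 := by ext j; exact hcon j
      simp only [Set.mem_ofPred_eq, this, nnnorm_zero, not_lt_zero] at hω
    rw [h0]
    exact zero_le
  · have hσ' : (0 : ℝ) < σw := by exact_mod_cast pos_iff_ne_zero.2 hσ
    have hn' : (0 : ℝ) < n := by exact_mod_cast hn
    set y : ℝ := n * Real.pi ^ 2 * ((t + 1 : ℕ) : ℝ) ^ 2 / (3 * η) with hy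
    have hy0 : 0 < y := by positivity
    have hy1 : 1 ≤ y := by
      rw [hy, le_div_iff₀ (by linarith)]
      have h1 : (1 : ℝ) ≤ n := by exact_mod_cast hn
      have h2 : (1 : ℝ) ≤ ((t + 1 : ℕ) : ℝ) ^ 2 := by
        have : (1 : ℝ) ≤ ((t + 1 : ℕ) : ℝ) := by push_cast; linarith [Nat.cast_nonneg (α := ℝ) t]
        nlinarith
      have h3 : (9 : ℝ) ≤ Real.pi ^ 2 := by nlinarith [Real.pi_gt_three]
      have h4 : (9 : ℝ) ≤ n * Real.pi ^ 2 := by nlinarith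
      have h5 : (9 : ℝ) ≤ n * Real.pi ^ 2 * ((t + 1 : ℕ) : ℝ) ^ 2 := by nlinarith
      linarith [hη.2]
    have hlog : 0 ≤ Real.log y := Real.log_nonneg hy1
    set r : ℝ := σw * √(2 * Real.log y) with hr
    have hr0 : 0 ≤ r := by positivity
    have hr2 : r ^ 2 = σw ^ 2 * (2 * Real.log y) := by rw [hr, mul_pow, Real.sq_sqrt (by positivity)]
    have hw : (wBar n σw (t + 1) η : ℝ) ^ 2 = n * r ^ 2 := by
      rw [wBar, if_neg (Nat.succ_ne_zero t)]
      push_cast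
      rw [Real.coe_toNNReal _ (Real.sqrt_nonneg _), mul_pow]
      push_cast at hy
      rw [← hy, Real.sq_sqrt (by positivity), hr2]
      ring
    have hsub : {ω | wBar n σw (t + 1) η < ‖(W (t + 1) ω : E n)‖₊} ⊆
        ⋃ j : Fin n, {ω | r ≤ |(W (t + 1) ω : E n) j|} := by
      intro ω hω
      by_contra hcon
      simp only [Set.mem_iUnion, Set.mem_ofPred_eq, not_exists, not_le] at hcon hω
      have h1 : (wBar n σw (t + 1) η : ℝ) < ‖(W (t + 1) ω : E n)‖ := by exact_mod_cast hω
      have h2 : ‖(W (t + 1) ω : E n)‖ ^ 2 ≤ n * r ^ 2 := by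
        rw [EuclideanSpace.real_norm_sq_eq]
        calc _ ≤ ∑ _j : Fin n, r ^ 2 := Finset.sum_le_sum fun j _ => by
              rw [← sq_abs]
              exact pow_le_pow_left₀ (abs_nonneg _) (hcon j).le 2
          _ = _ := by simp
      rw [← hw] at h2
      exact absurd (abs_le_of_sq_le_sq h2 (NNReal.coe_nonneg _)) (by rw [abs_norm]; exact not_le.2 h1)
    refine (measure_mono hsub).trans ((measure_iUnion_fintype_le _ _).trans ?_)
    calc _ ≤ ∑ _j : Fin n, ENNReal.ofReal (2 * Real.exp (-r ^ 2 / (2 * σw ^ 2))) :=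
          Finset.sum_le_sum fun j _ => hN.measure_abs_coord_ge t j hr0
      _ = ENNReal.ofReal (n * (2 * Real.exp (-r ^ 2 / (2 * σw ^ 2)))) := by
          rw [Finset.sum_const, Finset.card_univ, Fintype.card_fin, nsmul_eq_mul,
            ENNReal.ofReal_mul (p := (n : ℝ)) hn'.le, ENNReal.ofReal_natCast]
      _ = _ := by
          have : -r ^ 2 / (2 * (σw : ℝ) ^ 2) = -Real.log y := by
            rw [hr2]; field_simp
          rw [this, Real.exp_neg, Real.exp_log hy0, hy]
          congr 1
          push_cast
          field_simp
          norm_num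

theorem NoiseAssumption.measure_exists_norm_gt_wBar (hn : 0 < n)
    (hN : NoiseAssumption M P W S μw μs σw) {η : ℝ} (hη : η ∈ Set.Ioo (0 : ℝ) 1) :
    P {ω | ∃ t, wBar n σw (t + 1) η < ‖(W (t + 1) ω : E n)‖₊} ≤ ENNReal.ofReal η := by
  rw [← tsum_ofReal_inv_sq hη.1.le]
  have : {ω | ∃ t, wBar n σw (t + 1) η < ‖(W (t + 1) ω : E n)‖₊} =
      ⋃ t, {ω | wBar n σw (t + 1) η < ‖(W (t + 1) ω : E n)‖₊} := by
    ext; simp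
  rw [this]
  exact (measure_iUnion_le _).trans (ENNReal.tsum_le_tsum fun t => hN.measure_norm_gt_wBar hn hη t)

end Events

/-! ### Excitation -/

section Excitation

variable {n m d q : ℕ} {M : Model n m d q} {Ω : Type*} [MeasurableSpace Ω] {P : Measure Ω}
  [IsProbabilityMeasure P]
  {W : ℕ → Ω → M.W} {S : ℕ → Ω → M.S} {μw : Measure M.W} {μs : Measure M.S} {σw : ℝ≥0}
  {G : Growth} {XPE : Set (E n)} {c p : ℝ}

/-- The state and the control at time `i` respect the bounds `R` and `r`. -/
def Model.Bounded (M : Model n m d q) (R r : ℝ≥0) (h : ℕ → M.X × M.U) (i : ℕ) : Prop :=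
  ‖((h i).1 : E n)‖₊ ≤ R ∧ ‖((h i).2 : E m)‖₊ ≤ r

open Classical in
/-- The factor of the excitation supermartingale contributed by the step from `i` to `i + 1`. -/
def Model.exciteFactor (M : Model n m d q) (R r : ℝ≥0) (c p : ℝ) (ζ : E d) (i : ℕ)
    (h : ℕ → M.X × M.U) : ℝ :=
  if M.Bounded R r h i then
    Real.exp (p / 2 - Real.log 2 * if c ≤ |⟪ζ, M.ψ (h (i + 1))⟫| ^ 2 then 1 else 0)
  else 1

theorem Model.exciteFactor_nonneg (R r : ℝ≥0) (ζ : E d) (i : ℕ) (h : ℕ → M.X × M.U) :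
    0 ≤ M.exciteFactor R r c p ζ i h := by
  unfold exciteFactor
  split_ifs <;> positivity

theorem Model.measurable_exciteFactor (hM : MeasurableMaps M) (R r : ℝ≥0) (ζ : E d) (i : ℕ) :
    Measurable (M.exciteFactor R r c p ζ i) := by
  have h1 : Measurable fun h : ℕ → M.X × M.U => M.ψ (h (i + 1)) :=
    hM.ψ.comp (measurable_pi_apply (i + 1))
  have h2 : MeasurableSet {h : ℕ → M.X × M.U | M.Bounded R r h i} := by
    refine MeasurableSet.inter ?_ ?_
    · exact measurableSet_le (by fun_prop) measurable_const
    · exact measurableSet_le (by fun_prop) measurable_const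
  have h3 : MeasurableSet {h : ℕ → M.X × M.U | c ≤ |⟪ζ, M.ψ (h (i + 1))⟫| ^ 2} :=
    measurableSet_le measurable_const (((measurable_const.inner h1).abs).pow_const 2)
  refine Measurable.ite h2 (Real.measurable_exp.comp (measurable_const.sub
    (measurable_const.mul ?_))) measurable_const
  exact Measurable.ite h3 measurable_const measurable_const

theorem NoiseAssumption.isProbabilityMeasure_prod (hN : NoiseAssumption M P W S μw μs σw) :
    IsProbabilityMeasure (μw.prod μs) := by
  rw [← hN.map_prodMk 0]
  exact Measure.isProbabilityMeasure_map
    ((hN.measurable_W 0).prodMk (hN.measurable_S 1)).aemeasurable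

theorem NoiseAssumption.isProbabilityMeasure_μw (hN : NoiseAssumption M P W S μw μs σw) :
    IsProbabilityMeasure μw := by
  rw [← hN.law_W 0]
  exact Measure.isProbabilityMeasure_map (hN.measurable_W 0).aemeasurable

theorem NoiseAssumption.isProbabilityMeasure_μs (hN : NoiseAssumption M P W S μw μs σw) :
    IsProbabilityMeasure μs := by
  rw [← hN.law_S 0]
  exact Measure.isProbabilityMeasure_map (hN.measurable_S 0).aemeasurable

/-- Regional excitation, restated for one step of the closed loop. -/
theorem RegionallyExcited.le_measure_advance (hM : MeasurableMaps M)
    (hN : NoiseAssumption M P W S μw μs σw)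
    (hexc : RegionallyExcited M μs μw XPE c p) {R : ℝ≥0}
    (hR : reach M G (Metric.closedBall 0 R ∩ M.X) ⊆ XPE) {ζ : E d} (hζ : ‖ζ‖ = 1) {t : ℕ}
    {h : ℕ → M.X × M.U} (hh : M.Bounded R G.uMax h t) :
    ENNReal.ofReal p ≤
      (μw.prod μs) {z | c ≤ |⟪ζ, M.ψ (M.advance t (h, z) (t + 1))⟫| ^ 2} := by
  have := hN.isProbabilityMeasure_μw
  have := hN.isProbabilityMeasure_μs
  have hmem : M.predict (h t).1 (h t).2 ∈ XPE :=
    hR ⟨(h t).1, (h t).2, ⟨by simpa using (by exact_mod_cast hh.1 : ‖((h t).1 : E n)‖ ≤ R), (h t).1.2⟩, hh.2, rfl⟩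
  refine (hexc.excited (M.rls h t) _ hmem ζ hζ).trans ?_
  have hmeas : MeasurableSet {z : M.W × M.S | c ≤ |⟪ζ, M.ψ (M.advance t (h, z) (t + 1))⟫| ^ 2} := by
    have h1 : Measurable fun z : M.W × M.S => M.ψ (M.advance t (h, z) (t + 1)) :=
      hM.ψ.comp ((measurable_pi_apply (t + 1)).comp
        ((Model.measurable_advance hM t).comp (measurable_const.prodMk measurable_id)))
    exact measurableSet_le measurable_const (((measurable_const.inner h1).abs).pow_const 2)
  rw [← Measure.prod_swap (μ := μs), Measure.map_apply measurable_swap hmeas]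
  refine measure_mono ?_
  rintro a ⟨_, ha⟩
  simp only [Set.mem_preimage, Set.mem_ofPred_eq, Model.advance_succ]
  exact ha

/-- A hit halves the factor e^{p/2}, so its mean is e^{p/2}(1 - P(hit)/2) ≤ e^{p/2}(1 - p/2) ≤ 1.
Outside the bounds, where excitation is not available, the factor is 1; hence the inequality needs
no condition on `h`. -/
theorem RegionallyExcited.lintegral_exciteFactor_le (hM : MeasurableMaps M)
    (hN : NoiseAssumption M P W S μw μs σw)
    (hexc : RegionallyExcited M μs μw XPE c p) {R : ℝ≥0}
    (hR : reach M G (Metric.closedBall 0 R ∩ M.X) ⊆ XPE) {ζ : E d} (hζ : ‖ζ‖ = 1) (t : ℕ)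
    (h : ℕ → M.X × M.U) :
    ∫⁻ z, ENNReal.ofReal (M.exciteFactor R G.uMax c p ζ t (M.advance t (h, z))) ∂(μw.prod μs) ≤ 1 := by
  have := hN.isProbabilityMeasure_prod
  have hB : ∀ z, M.Bounded R G.uMax (M.advance t (h, z)) t ↔ M.Bounded R G.uMax h t := fun z => by
    rw [Model.Bounded, Model.advance_of_le _ _ _ le_rfl]; rfl
  by_cases hh : M.Bounded R G.uMax h t
  swap
  · have hB' : ∀ z, ¬ M.Bounded R G.uMax (M.advance t (h, z)) t := fun z => mt (hB z).1 hh
    simp [Model.exciteFactor, hB']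
  have hB' : ∀ z, M.Bounded R G.uMax (M.advance t (h, z)) t := fun z => (hB z).2 hh
  simp only [Model.exciteFactor, hB', if_true]
  set A := {z : M.W × M.S | c ≤ |⟪ζ, M.ψ (M.advance t (h, z) (t + 1))⟫| ^ 2} with hA
  have hAm : MeasurableSet A := by
    have h1 : Measurable fun z : M.W × M.S => M.ψ (M.advance t (h, z) (t + 1)) :=
      hM.ψ.comp ((measurable_pi_apply (t + 1)).comp
        ((Model.measurable_advance hM t).comp (measurable_const.prodMk measurable_id)))
    exact measurableSet_le measurable_const (((measurable_const.inner h1).abs).pow_const 2)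
  have hpA := hexc.le_measure_advance hM hN hR hζ hh
  rw [← hA] at hpA
  have hpA' : p ≤ (μw.prod μs).real A := by
    rwa [ENNReal.ofReal_le_iff_le_toReal (measure_ne_top _ _)] at hpA
  have e : ∀ z, ENNReal.ofReal (Real.exp (p / 2 - Real.log 2 *
      if c ≤ |⟪ζ, M.ψ (M.advance t (h, z) (t + 1))⟫| ^ 2 then 1 else 0)) =
      A.indicator (fun _ => ENNReal.ofReal (Real.exp (p / 2) / 2)) z
        + Aᶜ.indicator (fun _ => ENNReal.ofReal (Real.exp (p / 2))) z := by
    intro z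
    by_cases hz : z ∈ A
    · have hz' : c ≤ |⟪ζ, M.ψ (M.advance t (h, z) (t + 1))⟫| ^ 2 := hz
      simp only [hz', if_true, Set.indicator_of_mem hz, Set.indicator_of_notMem
        (Set.notMem_compl_iff.2 hz), add_zero, mul_one, Real.exp_sub, Real.exp_log two_pos]
    · have hz' : ¬ c ≤ |⟪ζ, M.ψ (M.advance t (h, z) (t + 1))⟫| ^ 2 := hz
      simp only [hz', if_false, Set.indicator_of_notMem hz, Set.indicator_of_mem
        (Set.mem_compl hz), zero_add, mul_zero, sub_zero]
  simp only [e]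
  rw [lintegral_add_left (by fun_prop (disch := exact hAm)), lintegral_indicator_const hAm,
    lintegral_indicator_const hAm.compl, ← ofReal_measureReal, ← ofReal_measureReal,
    ← ENNReal.ofReal_mul (by positivity), ← ENNReal.ofReal_mul (by positivity),
    ← ENNReal.ofReal_add (by positivity) (by positivity), probReal_compl_eq_one_sub hAm]
  refine ENNReal.ofReal_le_one.2 ?_
  have h1 : 1 - p / 2 ≤ Real.exp (-(p / 2)) := by
    have := Real.add_one_le_exp (-(p / 2)); linarith
  calc _ = Real.exp (p / 2) * (1 - (μw.prod μs).real A / 2) := by ring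
    _ ≤ Real.exp (p / 2) * Real.exp (-(p / 2)) := by gcongr; linarith
    _ = 1 := by rw [← Real.exp_add]; simp

/-- A lower tail bound for the energy of the regressor in a fixed direction. -/
theorem RegionallyExcited.measure_energy_lt (hM : MeasurableMaps M)
    (hN : NoiseAssumption M P W S μw μs σw)
    (hexc : RegionallyExcited M μs μw XPE c p) {R : ℝ≥0}
    (hR : reach M G (Metric.closedBall 0 R ∩ M.X) ⊆ XPE) {ζ : E d} (hζ : ‖ζ‖ = 1) (x₀ : M.X)
    (N : ℕ) :
    P {ω | (∀ i < N, M.Bounded R G.uMax (M.traj x₀ (fun i => W i ω) (fun i => S i ω)) i) ∧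
      ∑ i ∈ Finset.range N, ⟪ζ, M.ψ (M.traj x₀ (fun i => W i ω) (fun i => S i ω) (i + 1))⟫ ^ 2
        < c * p * N / 2} ≤ ENNReal.ofReal (Real.exp (-((1 - Real.log 2) * p * N / 2))) := by
  classical
  have hc := hexc.c_pos
  have key := hN.measure_exists_le hM x₀
    (K := fun t h => ∏ i ∈ Finset.range t, ENNReal.ofReal (M.exciteFactor R G.uMax c p ζ i h))
    (fun t => Finset.measurable_fun_prod _ fun i _ =>
      (Model.measurable_exciteFactor hM R G.uMax ζ i).ennreal_ofReal)
    (fun h => by simp) (fun t h h' hh => ?_) (fun t h => ?_)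
    (a := ENNReal.ofReal (Real.exp ((1 - Real.log 2) * p * N / 2)))
    (by simpa using Real.exp_pos _) ENNReal.ofReal_ne_top
  · rw [Real.exp_neg, ENNReal.ofReal_inv_of_pos (Real.exp_pos _)]
    refine (measure_mono ?_).trans key
    rintro ω ⟨hB, hlt⟩
    refine ⟨N, ?_⟩
    set h := M.traj x₀ (fun i => W i ω) (fun i => S i ω)
    rw [← ENNReal.ofReal_prod_of_nonneg fun i _ => M.exciteFactor_nonneg R G.uMax ζ i h]
    refine ENNReal.ofReal_le_ofReal ?_
    have e : ∏ i ∈ Finset.range N, M.exciteFactor R G.uMax c p ζ i h = Real.exp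
        (∑ i ∈ Finset.range N, (p / 2 - Real.log 2 *
          if c ≤ |⟪ζ, M.ψ (h (i + 1))⟫| ^ 2 then 1 else 0)) := by
      rw [Real.exp_sum]
      refine Finset.prod_congr rfl fun i hi => ?_
      rw [Model.exciteFactor, if_pos (hB i (Finset.mem_range.1 hi))]
    rw [e, Real.exp_le_exp, Finset.sum_sub_distrib, ← Finset.mul_sum]
    set k := ∑ i ∈ Finset.range N, (if c ≤ |⟪ζ, M.ψ (h (i + 1))⟫| ^ 2 then (1 : ℝ) else 0) with hk
    have hck : c * k ≤ ∑ i ∈ Finset.range N, ⟪ζ, M.ψ (h (i + 1))⟫ ^ 2 := by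
      rw [hk, Finset.mul_sum]
      refine Finset.sum_le_sum fun i _ => ?_
      split_ifs with hi
      · rw [mul_one, ← sq_abs]; exact hi
      · rw [mul_zero]; positivity
    -- Each hit contributes energy at least c, so low energy means at most pN/2 hits. The exponent
    -- is then at least pN/2 - ln 2 · pN/2, the logarithm of the chosen level.
    have hk2 : k ≤ p * N / 2 := by
      have : c * k ≤ c * (p * N / 2) := by linarith
      exact le_of_mul_le_mul_left this hc
    have := mul_le_mul_of_nonneg_left hk2 (Real.log_nonneg one_le_two)
    simp only [Finset.sum_const, Finset.card_range, nsmul_eq_mul]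
    linarith
  · refine Finset.prod_congr rfl fun i hi => ?_
    have := Finset.mem_range.1 hi
    rw [Model.exciteFactor, Model.exciteFactor, Model.Bounded, Model.Bounded, hh i (by omega),
      hh (i + 1) (by omega)]
  · have hfst : ∀ z, ∏ i ∈ Finset.range (t + 1),
        ENNReal.ofReal (M.exciteFactor R G.uMax c p ζ i (M.advance t (h, z))) =
        (∏ i ∈ Finset.range t, ENNReal.ofReal (M.exciteFactor R G.uMax c p ζ i h)) *
          ENNReal.ofReal (M.exciteFactor R G.uMax c p ζ t (M.advance t (h, z))) := by
      intro z
      rw [Finset.prod_range_succ]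
      congr 1
      refine Finset.prod_congr rfl fun i hi => ?_
      have := Finset.mem_range.1 hi
      rw [Model.exciteFactor, Model.exciteFactor, Model.Bounded, Model.Bounded,
        M.advance_of_le t i (by omega), M.advance_of_le t (i + 1) (by omega)]
    simp only [hfst]
    rw [lintegral_const_mul]
    · calc _ ≤ (∏ i ∈ Finset.range t, ENNReal.ofReal (M.exciteFactor R G.uMax c p ζ i h)) * 1 := by
            gcongr
            exact hexc.lintegral_exciteFactor_le hM hN hR hζ t h
        _ = _ := mul_one _
    · exact ((Model.measurable_exciteFactor hM R G.uMax ζ t).comp ((Model.measurable_advance hM t).comp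
        (measurable_const.prodMk measurable_id))).ennreal_ofReal

/-- A net of the unit sphere fine enough for a quadratic form of size `Z` at the level `κ`. -/
theorem exists_net_of_energy (hd : 0 < d) {Z κ : ℝ} (hZ : 0 ≤ Z) (hκ : 0 < κ) :
    ∃ s : Finset (E d), (∀ x ∈ s, ‖x‖ = 1) ∧ (s.card : ℝ) ≤ (1 + 16 * Z / κ) ^ d ∧
      ∀ x : E d, ‖x‖ = 1 → ∃ y ∈ s, 2 * ‖x - y‖ * Z ≤ κ / 4 := by
  -- For Z = 0 the radius κ/(8Z) is meaningless, but any single unit vector serves; one exists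
  -- because d > 0.
  rcases hZ.eq_or_lt with rfl | hZ
  · refine ⟨{EuclideanSpace.single ⟨0, hd⟩ 1}, by simp, by simp, fun x _ => ⟨_, Finset.mem_singleton_self _, ?_⟩⟩
    rw [mul_zero]; positivity
  · obtain ⟨s, h1, h2, h3⟩ := exists_net_unit_sphere (V := E d) (ε := κ / (8 * Z)) (by positivity)
    refine ⟨s, h1, h2.trans_eq ?_, fun x hx => ?_⟩
    · rw [finrank_euclideanSpace_fin]
      congr 2
      field_simp
      norm_num
    · obtain ⟨y, hy, hxy⟩ := h3 x hx
      refine ⟨y, hy, ?_⟩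
      calc 2 * ‖x - y‖ * Z ≤ 2 * (κ / (8 * Z)) * Z := by gcongr
        _ = κ / 4 := by field_simp; norm_num

/-- The difference of two squared inner products factors as ⟪y - x, v⟫⟪y + x, v⟫, and |y + x| ≤ 2.
-/
theorem energy_sub_le {ι : Type*} (s : Finset ι) (v : ι → E d) {x y : E d} (hx : ‖x‖ = 1)
    (hy : ‖y‖ = 1) {Z : ℝ} (hZ : ∑ i ∈ s, ‖v i‖ ^ 2 ≤ Z) :
    ∑ i ∈ s, ⟪y, v i⟫ ^ 2 ≤ ∑ i ∈ s, ⟪x, v i⟫ ^ 2 + 2 * ‖x - y‖ * Z := by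
  have h : ∀ i ∈ s, ⟪y, v i⟫ ^ 2 ≤ ⟪x, v i⟫ ^ 2 + 2 * ‖x - y‖ * ‖v i‖ ^ 2 := by
    intro i _
    have h1 : ⟪y, v i⟫ ^ 2 - ⟪x, v i⟫ ^ 2 = ⟪y - x, v i⟫ * ⟪y + x, v i⟫ := by
      rw [inner_sub_left, inner_add_left]; ring
    have h2 : |⟪y - x, v i⟫| ≤ ‖x - y‖ * ‖v i‖ := by
      rw [norm_sub_rev]; exact abs_real_inner_le_norm _ _
    have h3 : |⟪y + x, v i⟫| ≤ 2 * ‖v i‖ := by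
      refine (abs_real_inner_le_norm _ _).trans ?_
      gcongr
      exact (norm_add_le _ _).trans (by rw [hx, hy]; norm_num)
    have h4 : ⟪y - x, v i⟫ * ⟪y + x, v i⟫ ≤ ‖x - y‖ * ‖v i‖ * (2 * ‖v i‖) := by
      refine (le_abs_self _).trans ?_
      rw [abs_mul]
      exact mul_le_mul h2 h3 (abs_nonneg _) (by positivity)
    linarith
  calc _ ≤ ∑ i ∈ s, (⟪x, v i⟫ ^ 2 + 2 * ‖x - y‖ * ‖v i‖ ^ 2) := Finset.sum_le_sum h
    _ = ∑ i ∈ s, ⟪x, v i⟫ ^ 2 + 2 * ‖x - y‖ * ∑ i ∈ s, ‖v i‖ ^ 2 := by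
      rw [Finset.sum_add_distrib, Finset.mul_sum]
    _ ≤ _ := by gcongr

/-- A lower tail bound for the smallest eigenvalue of the Gramian. -/
theorem RegionallyExcited.measure_exists_energy_lt (hd : 0 < d) (hM : MeasurableMaps M)
    (hN : NoiseAssumption M P W S μw μs σw)
    (hexc : RegionallyExcited M μs μw XPE c p) {R : ℝ≥0}
    (hR : reach M G (Metric.closedBall 0 R ∩ M.X) ⊆ XPE) (x₀ : M.X) {t : ℕ} (ht : 2 ≤ t)
    {Z : ℝ} (hZ : 0 ≤ Z) :
    P {ω | (∀ i < t, M.Bounded R G.uMax (M.traj x₀ (fun i => W i ω) (fun i => S i ω)) i) ∧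
      ∑ i ∈ Finset.range t, ‖M.ψ (M.traj x₀ (fun i => W i ω) (fun i => S i ω) i)‖ ^ 2 ≤ Z ∧
      ∃ ζ : E d, ‖ζ‖ = 1 ∧
        ∑ i ∈ Finset.range t, ⟪ζ, M.ψ (M.traj x₀ (fun i => W i ω) (fun i => S i ω) i)⟫ ^ 2
        < c * p / 4 * ((t : ℝ) - 1)} ≤
      ENNReal.ofReal ((1 + 16 * Z / (c * p * ((t : ℝ) - 1))) ^ d *
        Real.exp (-((1 - Real.log 2) * p * ((t : ℝ) - 1) / 2))) := by
  have ht1 : (0 : ℝ) < (t : ℝ) - 1 := by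
    have : (2 : ℝ) ≤ t := by exact_mod_cast ht
    linarith
  have hc := hexc.c_pos
  have hp := hexc.p_pos
  obtain ⟨s, hs1, hs2, hs3⟩ := exists_net_of_energy (d := d) hd hZ
    (κ := c * p * ((t : ℝ) - 1)) (by positivity)
  -- Excitation controls only regressors produced by a step, so the one at time 0 is discarded and t
  -- - 1 remain.
  obtain ⟨N, rfl⟩ : ∃ N, t = N + 1 := ⟨t - 1, by omega⟩
  have hcast : ((N + 1 : ℕ) : ℝ) - 1 = N := by push_cast; ring
  rw [hcast] at ht1 hs2 hs3 ⊢
  let A : E d → Set Ω := fun ζ =>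
    {ω | (∀ i < N, M.Bounded R G.uMax (M.traj x₀ (fun i => W i ω) (fun i => S i ω)) i) ∧
      ∑ i ∈ Finset.range N, ⟪ζ, M.ψ (M.traj x₀ (fun i => W i ω) (fun i => S i ω) (i + 1))⟫ ^ 2
        < c * p * N / 2}
  calc _ ≤ P (⋃ ζ ∈ s, A ζ) := by
        refine measure_mono ?_
        -- Moving to the nearest net point adds at most κ/4 to an energy below κ/4, where κ = cpN;
        -- this is the level κ/2 of the tail bound for fixed directions.
        rintro ω ⟨hB, hZω, ζ, hζ, hlt⟩
        obtain ⟨y, hy, hζy⟩ := hs3 ζ hζ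
        refine Set.mem_biUnion hy ⟨fun i hi => hB i (by omega), ?_⟩
        have h1 := energy_sub_le _ (fun i => M.ψ (M.traj x₀ (fun i => W i ω) (fun i => S i ω) i))
          hζ (hs1 y hy) hZω
        have h2 : ∑ i ∈ Finset.range N,
            ⟪y, M.ψ (M.traj x₀ (fun i => W i ω) (fun i => S i ω) (i + 1))⟫ ^ 2 ≤
            ∑ i ∈ Finset.range (N + 1),
            ⟪y, M.ψ (M.traj x₀ (fun i => W i ω) (fun i => S i ω) i)⟫ ^ 2 := by
          rw [Finset.sum_range_succ']
          exact le_add_of_nonneg_right (sq_nonneg _)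
        linarith
    _ ≤ ∑ ζ ∈ s, P (A ζ) := measure_biUnion_finset_le _ _
    _ ≤ ∑ _ζ ∈ s, ENNReal.ofReal (Real.exp (-((1 - Real.log 2) * p * N / 2))) :=
        Finset.sum_le_sum fun ζ hζ => hexc.measure_energy_lt hM hN hR (hs1 ζ hζ) x₀ N
    _ = ENNReal.ofReal (s.card * Real.exp (-((1 - Real.log 2) * p * N / 2))) := by
        rw [Finset.sum_const, nsmul_eq_mul, ENNReal.ofReal_mul (Nat.cast_nonneg _),
          ENNReal.ofReal_natCast]
    _ ≤ _ := by
        refine ENNReal.ofReal_le_ofReal ?_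
        gcongr

end Excitation

/-! ### Growth of the bounds and the burn-in time -/

/-- Sequences that grow more slowly than every exponential. -/
def SubExpSeq (a : ℕ → ℝ) : Prop := ∀ ε > 0, ∀ᶠ t : ℕ in atTop, a t ≤ Real.exp (ε * t)

namespace SubExpSeq

theorem of_eventually_le {a b : ℕ → ℝ} (hb : SubExpSeq b) (h : ∀ᶠ t in atTop, a t ≤ b t) :
    SubExpSeq a := fun ε hε => by
  filter_upwards [h, hb ε hε] with t h1 h2 using h1.trans h2

theorem const (C : ℝ) : SubExpSeq fun _ => C := fun ε hε => by
  have h : Tendsto (fun t : ℕ => Real.exp (ε * t)) atTop atTop :=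
    Real.tendsto_exp_atTop.comp (tendsto_natCast_atTop_atTop.const_mul_atTop hε)
  exact h.eventually_ge_atTop C

theorem mul {a b : ℕ → ℝ} (ha : SubExpSeq a) (hb : SubExpSeq b) (hb0 : ∀ t, 0 ≤ b t) :
    SubExpSeq fun t => a t * b t := fun ε hε => by
  filter_upwards [ha (ε / 2) (by positivity), hb (ε / 2) (by positivity)] with t h1 h2
  calc a t * b t ≤ Real.exp (ε / 2 * t) * Real.exp (ε / 2 * t) :=
        mul_le_mul h1 h2 (hb0 t) (Real.exp_nonneg _)
    _ = Real.exp (ε * t) := by rw [← Real.exp_add]; congr 1; ring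

theorem add {a b : ℕ → ℝ} (ha : SubExpSeq a) (hb : SubExpSeq b) :
    SubExpSeq fun t => a t + b t := fun ε hε => by
  filter_upwards [ha (ε / 2) (by positivity), hb (ε / 2) (by positivity),
    const 2 (ε / 2) (by positivity)] with t h1 h2 h3
  calc a t + b t ≤ 2 * Real.exp (ε / 2 * t) := by linarith
    _ ≤ Real.exp (ε / 2 * t) * Real.exp (ε / 2 * t) := by gcongr
    _ = Real.exp (ε * t) := by rw [← Real.exp_add]; congr 1; ring

theorem pow {a : ℕ → ℝ} (ha : SubExpSeq a) (ha0 : ∀ t, 0 ≤ a t) (k : ℕ) :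
    SubExpSeq fun t => a t ^ k := by
  induction k with
  | zero => simpa using const 1
  | succ k ih => simpa only [pow_succ] using ih.mul ha ha0

theorem natCast : SubExpSeq fun t => (t : ℝ) := fun ε hε => by
  filter_upwards [tendsto_natCast_atTop_atTop.eventually_ge_atTop (2 / ε ^ 2)] with t ht
  have h0 : (0 : ℝ) ≤ t := Nat.cast_nonneg t
  have h1 := Real.quadratic_le_exp_of_nonneg (x := ε * t) (by positivity)
  rw [div_le_iff₀ (by positivity)] at ht
  have h2 : 0 ≤ ε * t := by positivity
  nlinarith

end SubExpSeq

theorem IsSubExp.eventually_le {k : ℕ} {χ : ℝ≥0 → ℝ≥0} (h : IsSubExp k χ) {ε : ℝ} (hε : 0 < ε) :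
    ∀ᶠ r : ℝ≥0 in atTop, (χ (r ^ k) : ℝ) ≤ Real.exp (ε * r) := by
  filter_upwards [h.eventually_lt_const hε, eventually_gt_atTop 0] with r h1 h2
  have hr : (0 : ℝ) < r := h2
  rw [div_lt_iff₀ hr] at h1
  -- The value zero is treated apart, since `Real.log 0 = 0` carries no information.
  rcases (χ (r ^ k)).2.eq_or_lt with h0 | h0
  · change (0 : ℝ) = (χ (r ^ k) : ℝ) at h0
    rw [← h0]; positivity
  · exact (Real.log_le_iff_le_exp h0).1 h1.le

section Growth

variable {G : Growth} {n : ℕ} {σw : ℝ≥0} {δ : ℝ}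

theorem wBar_mono (hn : 0 < n) (hδ : 0 < δ) : Monotone fun t => wBar n σw t δ := by
  intro s t hst
  by_cases hs : s = 0
  · simp [wBar, hs]
  · have ht : t ≠ 0 := by omega
    have hs' : (0 : ℝ) < s := by exact_mod_cast Nat.pos_of_ne_zero hs
    have hn' : (0 : ℝ) < n := by exact_mod_cast hn
    have hst' : (s : ℝ) ≤ t := by exact_mod_cast hst
    simp only [wBar, hs, ht, if_false]
    gcongr

theorem xBar_mono (h1 : Monotone G.χ₁) (h3 : Monotone G.χ₃) (h4 : Monotone G.χ₄)
    (h2 : Monotone G.σ₂) (hn : 0 < n) (hδ : 0 < δ) (r : ℝ≥0) :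
    Monotone fun t => xBar G n σw t δ r := by
  intro s t hst
  have hst' : (s : ℝ≥0) ≤ t := by exact_mod_cast hst
  have hw := h2 (wBar_mono (σw := σw) hn hδ hst)
  simp only at hw
  unfold xBar
  refine add_le_add (add_le_add (add_le_add (add_le_add (h1 hst') le_rfl) (h3 ?_)) (h4 ?_)) le_rfl
  · gcongr
  · gcongr

theorem zBar_mono (hx : Monotone fun t => xBar G n σw t δ r) (h5 : Monotone G.χ₅) :
    Monotone fun t => zBar G n σw t δ r := by
  intro s t hst
  refine h5 (NNReal.sqrt_le_sqrt.2 ?_)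
  have := hx (show s - 1 ≤ t - 1 by omega)
  simp only at this
  gcongr

/-- The noise bound grows like √(ln t). Comparison with ln t is what suits σ₂: being 1-SE, it gives
σ₂(ln t) ≤ t eventually. -/
theorem eventually_wBar_le_log (n : ℕ) (σw : ℝ≥0) (hδ : 0 < δ) :
    ∀ᶠ t : ℕ in atTop, (wBar n σw t δ : ℝ) ≤ Real.log t := by
  have hlog : Tendsto (fun t : ℕ => Real.log t) atTop atTop :=
    Real.tendsto_log_atTop.comp tendsto_natCast_atTop_atTop
  set A := Real.log (n * Real.pi ^ 2 / (3 * δ)) with hA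
  filter_upwards [hlog.eventually_ge_atTop (2 * (σw : ℝ) ^ 2 * n * (|A| + 2) + 1),
    eventually_gt_atTop 0] with t h1 h2
  have ht : (0 : ℝ) < t := by exact_mod_cast h2
  have hL : 1 ≤ Real.log t := le_trans (by
    have : 0 ≤ 2 * (σw : ℝ) ^ 2 * n * (|A| + 2) := by positivity
    linarith) h1
  rw [wBar, if_neg h2.ne']
  push_cast
  rw [Real.coe_toNNReal _ (Real.sqrt_nonneg _)]
  rcases Nat.eq_zero_or_pos n with rfl | hn
  · simp; linarith
  have hn' : (0 : ℝ) < n := by exact_mod_cast hn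
  have e : Real.log (n * Real.pi ^ 2 * (t : ℝ) ^ 2 / (3 * δ)) = A + 2 * Real.log t := by
    have hpos : 0 < n * Real.pi ^ 2 / (3 * δ) := by positivity
    rw [mul_div_right_comm, Real.log_mul hpos.ne' (by positivity), Real.log_pow]
    push_cast
    rfl
  rw [e]
  set L := Real.log t
  have hsq : (σw : ℝ) ^ 2 * (2 * n * (|A| + 2 * L)) ≤ L ^ 2 := by
    have h3 : (σw : ℝ) ^ 2 * (2 * n * (|A| + 2 * L)) ≤ (2 * (σw : ℝ) ^ 2 * n * (|A| + 2)) * L := by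
      have h4 : |A| ≤ |A| * L := le_mul_of_one_le_right (abs_nonneg _) hL
      calc _ = 2 * (σw : ℝ) ^ 2 * n * (|A| + 2 * L) := by ring
        _ ≤ 2 * (σw : ℝ) ^ 2 * n * (|A| * L + 2 * L) := by gcongr
        _ = _ := by ring
    have h5 : (2 * (σw : ℝ) ^ 2 * n * (|A| + 2)) * L ≤ L * L := by gcongr; linarith
    linarith [sq L]
  calc (σw : ℝ) * √(2 * n * (A + 2 * L)) ≤ σw * √(2 * n * (|A| + 2 * L)) := by
        gcongr; exact le_abs_self A
    _ = √((σw : ℝ) ^ 2 * (2 * n * (|A| + 2 * L))) := by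
        rw [Real.sqrt_mul (sq_nonneg (σw : ℝ)), Real.sqrt_sq (NNReal.coe_nonneg _)]
    _ ≤ √(L ^ 2) := Real.sqrt_le_sqrt hsq
    _ = L := Real.sqrt_sq (by linarith)

theorem tendsto_natCast_nnreal : Tendsto (fun t : ℕ => (t : ℝ≥0)) atTop atTop :=
  tendsto_natCast_atTop_atTop

/-- The critical term is χ₄(t σ₂(w̄(t))): eventually σ₂(w̄(t)) ≤ t, so the argument is at most t²,
the growth that a 2-SE function tolerates. -/
theorem subExpSeq_xBar (h1 : IsSubExp 1 G.χ₁) (h3 : IsSubExp 1 G.χ₃) (h3m : Monotone G.χ₃)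
    (h4 : IsSubExp 2 G.χ₄) (h4m : Monotone G.χ₄) (h2 : IsSubExp 1 G.σ₂) (h2m : Monotone G.σ₂)
    (hδ : 0 < δ) (r : ℝ≥0) : SubExpSeq fun t => (xBar G n σw t δ r : ℝ) := by
  have hχ₁ : SubExpSeq fun t => (G.χ₁ t : ℝ) := fun ε hε => by
    simpa using tendsto_natCast_nnreal.eventually (h1.eventually_le hε)
  have hχ₃ : SubExpSeq fun t => (G.χ₃ (t * G.σ₁ G.uMax) : ℝ) := fun ε hε => by
    -- The added 1 keeps the slope positive, so that t·a tends to infinity even if σ₁(u_max) = 0.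
    set a := G.σ₁ G.uMax + 1
    have ha : (0 : ℝ) < a := by positivity
    have ht : Tendsto (fun t : ℕ => (t : ℝ≥0) * a) atTop atTop :=
      tendsto_natCast_nnreal.atTop_mul_const (by positivity)
    filter_upwards [ht.eventually (h3.eventually_le (div_pos hε ha))] with t h
    rw [pow_one] at h
    calc (G.χ₃ (t * G.σ₁ G.uMax) : ℝ) ≤ G.χ₃ (t * a) := by
          exact_mod_cast h3m (by gcongr; exact le_self_add)
      _ ≤ _ := h
      _ = Real.exp (ε * t) := by push_cast; congr 1; field_simp
  have hσ : ∀ᶠ t : ℕ in atTop, G.σ₂ (wBar n σw t δ) ≤ t := by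
    have hlog : Tendsto (fun t : ℕ => Real.toNNReal (Real.log t)) atTop atTop :=
      tendsto_real_toNNReal_atTop.comp (Real.tendsto_log_atTop.comp tendsto_natCast_atTop_atTop)
    filter_upwards [hlog.eventually (h2.eventually_le one_pos), eventually_wBar_le_log n σw hδ,
      eventually_gt_atTop 0] with t ht1 ht2 ht3
    have ht : (1 : ℝ) ≤ t := by exact_mod_cast ht3
    rw [pow_one, one_mul, Real.coe_toNNReal _ (Real.log_nonneg ht), Real.exp_log (by linarith)] at ht1
    have h5 : G.σ₂ (wBar n σw t δ) ≤ G.σ₂ (Real.toNNReal (Real.log t)) :=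
      h2m (NNReal.le_toNNReal_of_coe_le ht2)
    exact h5.trans (by exact_mod_cast ht1)
  have hχ₄ : SubExpSeq fun t => (G.χ₄ (t * G.σ₂ (wBar n σw t δ)) : ℝ) := fun ε hε => by
    filter_upwards [hσ, tendsto_natCast_nnreal.eventually (h4.eventually_le hε)] with t ht1 ht2
    refine le_trans ?_ ht2
    have : G.χ₄ (t * G.σ₂ (wBar n σw t δ)) ≤ G.χ₄ ((t : ℝ≥0) ^ 2) := h4m (by rw [sq]; gcongr)
    exact_mod_cast this
  have := (((hχ₁.add (.const (G.χ₂ r))).add hχ₃).add hχ₄).add (.const G.c₁)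
  simpa only [xBar, NNReal.coe_add] using this

theorem subExpSeq_sumZBar (hx : SubExpSeq fun t => (xBar G n σw t δ r : ℝ))
    (hxm : Monotone fun t => xBar G n σw t δ r) (h5 : Monotone G.χ₅) (hapb : IsAPB G.χ₅) :
    SubExpSeq fun t => sumZBar G n σw t δ r := by
  obtain ⟨k, hk⟩ := hapb
  obtain ⟨C, hC⟩ := hk.bound
  -- The summand t forces `Y` to infinity, as the asymptotic bound on χ₅ requires; x̄ alone need not
  -- be known to diverge.
  let Y : ℕ → ℝ≥0 := fun t => xBar G n σw t δ r + G.uMax + t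
  have hY : Tendsto Y atTop atTop :=
    tendsto_atTop_mono (fun t => le_add_self) tendsto_natCast_nnreal
  have hYs : SubExpSeq fun t => (Y t : ℝ) := by
    simpa only [Y, NNReal.coe_add, NNReal.coe_natCast] using (hx.add (.const G.uMax)).add .natCast
  have hz : SubExpSeq fun t => (zBar G n σw t δ r : ℝ) := by
    refine ((SubExpSeq.const |C|).mul (hYs.pow (fun t => NNReal.coe_nonneg _) k)
      (fun t => by positivity)).of_eventually_le ?_
    filter_upwards [hY.eventually hC] with t ht
    have h1 : zBar G n σw t δ r ≤ G.χ₅ (Y t) := by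
      refine h5 ?_
      have h6 : xBar G n σw (t - 1) δ r ≤ xBar G n σw t δ r := hxm (Nat.sub_le t 1)
      calc NNReal.sqrt (xBar G n σw (t - 1) δ r ^ 2 + G.uMax ^ 2)
          ≤ NNReal.sqrt ((xBar G n σw t δ r + G.uMax) ^ 2) := by
            refine NNReal.sqrt_le_sqrt.2 ?_
            calc _ ≤ xBar G n σw t δ r ^ 2 + G.uMax ^ 2 := by gcongr
              _ ≤ xBar G n σw t δ r ^ 2 + G.uMax ^ 2 + 2 * xBar G n σw t δ r * G.uMax :=
                le_self_add
              _ = _ := by ring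
        _ = xBar G n σw t δ r + G.uMax := NNReal.sqrt_sq _
        _ ≤ Y t := le_self_add
    have h2 : (zBar G n σw t δ r : ℝ) ≤ G.χ₅ (Y t) := by exact_mod_cast h1
    simp only [Real.norm_eq_abs, NNReal.abs_eq, abs_pow] at ht
    exact h2.trans (ht.trans (by gcongr; exact le_abs_self C))
  refine ((SubExpSeq.natCast).mul (hz.pow (fun t => NNReal.coe_nonneg _) 2)
    (fun t => by positivity)).of_eventually_le (.of_forall fun t => ?_)
  have hzm := zBar_mono hxm h5
  calc sumZBar G n σw t δ r ≤ ∑ _i ∈ Finset.Icc 1 t, (zBar G n σw t δ r : ℝ) ^ 2 := by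
        refine Finset.sum_le_sum fun i hi => ?_
        have : zBar G n σw i δ r ≤ zBar G n σw t δ r := hzm (Finset.mem_Icc.1 hi).2
        gcongr
    _ = t * (zBar G n σw t δ r : ℝ) ^ 2 := by simp

theorem sumZBar_nonneg (t : ℕ) (δ : ℝ) (r : ℝ≥0) : 0 ≤ sumZBar G n σw t δ r :=
  Finset.sum_nonneg fun _ _ => sq_nonneg _

end Growth

section BurnIn

variable {n m d q : ℕ} {M : Model n m d q} {G : Growth} {σw : ℝ≥0} {c p δ : ℝ}

theorem one_sub_log_two_pos : 0 < 1 - Real.log 2 := by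
  have := Real.log_two_lt_d9
  linarith

/-- Both logarithms are o(t), because their arguments are subexponential, so the linear left-over
t/2 eventually dominates. -/
theorem exists_burnedIn (hc : 0 < c) (hp : 0 < p) (hδ : 0 < δ) (x₀ : M.X)
    (hZ : SubExpSeq fun t => sumZBar G n σw t (δ / 3) ‖(x₀ : E n)‖₊) :
    ∃ T, 1 ≤ T ∧ BurnedIn M G σw c p δ x₀ T := by
  have hl := one_sub_log_two_pos
  set K := 2 / ((1 - Real.log 2) * p) with hK
  have hK0 : 0 < K := by positivity
  -- Chosen so that the d + 1 logarithms, each at most εt, sum to t/2 after multiplication by `K`.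
  set ε : ℝ := 1 / (2 * K * (d + 1)) with hε
  have hε0 : 0 < ε := by positivity
  have h1 : SubExpSeq fun t => 1 + 16 / (c * p) * sumZBar G n σw t (δ / 3) ‖(x₀ : E n)‖₊ :=
    (SubExpSeq.const 1).add ((SubExpSeq.const _).mul hZ fun t => sumZBar_nonneg _ _ _)
  have h2 : SubExpSeq fun t => Real.pi ^ 2 / (2 * δ) * (t : ℝ) ^ 2 :=
    (SubExpSeq.const _).mul (SubExpSeq.natCast.pow (fun t => Nat.cast_nonneg t) 2)
      fun t => by positivity
  obtain ⟨T, hT⟩ := eventually_atTop.1 ((h1 ε hε0).and (h2 ε hε0))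
  -- The shift by 2 ensures t - 1 ≥ 1 in the denominator and t/2 + 1 ≤ t at the end.
  refine ⟨T + 2, by omega, fun t ht => ?_⟩
  obtain ⟨ht1, ht2⟩ := hT t (by omega)
  have ht' : (2 : ℝ) + T ≤ t := by exact_mod_cast (by omega : 2 + T ≤ t)
  have hT0 : (0 : ℝ) ≤ T := Nat.cast_nonneg T
  have hZ0 := sumZBar_nonneg (G := G) (n := n) (σw := σw) t (δ / 3) ‖(x₀ : E n)‖₊
  set Z := sumZBar G n σw t (δ / 3) ‖(x₀ : E n)‖₊
  have hcp : 0 < c * p := by positivity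
  have hq : 16 * Z / (c * p * ((t : ℝ) - 1)) ≤ 16 / (c * p) * Z := by
    rw [div_mul_eq_mul_div]
    refine div_le_div_of_nonneg_left (by positivity) hcp ?_
    exact le_mul_of_one_le_right hcp.le (by linarith)
  have hq0 : 0 ≤ 16 * Z / (c * p * ((t : ℝ) - 1)) :=
    div_nonneg (by positivity) (mul_nonneg hcp.le (by linarith))
  have h3 : Real.log (1 + 16 * Z / (c * p * ((t : ℝ) - 1))) ≤ ε * t := by
    rw [Real.log_le_iff_le_exp (by linarith)]
    linarith
  have h4 : Real.log (Real.pi ^ 2 * ((t : ℝ) - (T + 2 : ℕ) + 1) ^ 2 / (2 * δ)) ≤ ε * t := by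
    push_cast
    have h5 : 0 < (t : ℝ) - (T + 2) + 1 := by linarith
    rw [Real.log_le_iff_le_exp (by positivity)]
    refine le_trans ?_ ht2
    change _ ≤ Real.pi ^ 2 / (2 * δ) * (t : ℝ) ^ 2
    rw [div_mul_eq_mul_div]
    gcongr
    linarith
  have h6 : K * (d * (ε * t) + ε * t) = t / 2 := by
    rw [hε]; field_simp
  calc _ ≤ K * (d * (ε * t) + ε * t) + 1 := by gcongr
    _ ≤ t := by rw [h6]; linarith

theorem tBurnIn_eq (x₀ : M.X) (h : ∃ T, 1 ≤ T ∧ BurnedIn M G σw c p δ x₀ T) :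
    ∃ T : ℕ, tBurnIn M G σw c p δ x₀ = T ∧ 1 ≤ T ∧ BurnedIn M G σw c p δ x₀ T := by
  classical
  refine ⟨Nat.find h, le_antisymm (iInf₂_le (Nat.find h) (Nat.find_spec h)) ?_, Nat.find_spec h⟩
  exact le_iInf₂ fun T hT => by exact_mod_cast Nat.find_min' h hT

/-- At T = t = 1 the quotient is 0 by the convention on division by zero, and the condition would
require ln(π²/(2δ)) ≤ 0. So t - 1 > 0 after burn-in. -/
theorem BurnedIn.two_le (hp : 0 < p) (hδ : δ ∈ Set.Ioo (0 : ℝ) 1) {x₀ : M.X} {T : ℕ} (hT : 1 ≤ T)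
    (h : BurnedIn M G σw c p δ x₀ T) : 2 ≤ T := by
  by_contra hlt
  obtain rfl : T = 1 := by omega
  have := h 1 le_rfl
  have hl := one_sub_log_two_pos
  have hδ0 := hδ.1
  have hpos : 0 < Real.log (Real.pi ^ 2 / (2 * δ)) := by
    refine Real.log_pos ?_
    rw [lt_div_iff₀ (by positivity)]
    nlinarith [Real.pi_gt_three, hδ.2]
  simp only [Nat.cast_one, sub_self, mul_zero, div_zero, add_zero, Real.log_one, zero_add, one_pow,
    mul_one] at this
  have h2 : 0 < 2 / ((1 - Real.log 2) * p) * Real.log (Real.pi ^ 2 / (2 * δ)) := by positivity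
  linarith

/-- After the burn-in time the union bound over the net is summable. -/
theorem BurnedIn.mul_exp_le (hc : 0 < c) (hp : 0 < p) (hδ : 0 < δ) {x₀ : M.X} {T : ℕ} (hT : 2 ≤ T)
    (h : BurnedIn M G σw c p δ x₀ T) (k : ℕ) :
    (1 + 16 * sumZBar G n σw (T + k) (δ / 3) ‖(x₀ : E n)‖₊ / (c * p * (((T + k : ℕ) : ℝ) - 1))) ^ d
      * Real.exp (-((1 - Real.log 2) * p * (((T + k : ℕ) : ℝ) - 1) / 2))
      ≤ 6 * (δ / 3) / (Real.pi ^ 2 * ((k : ℝ) + 1) ^ 2) := by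
  have hl := one_sub_log_two_pos
  have := h (T + k) (by omega)
  have hT1 : (0 : ℝ) < ((T + k : ℕ) : ℝ) - 1 := by
    have : (2 : ℝ) ≤ ((T + k : ℕ) : ℝ) := by exact_mod_cast (by omega : 2 ≤ T + k)
    linarith
  have hZ0 := sumZBar_nonneg (G := G) (n := n) (σw := σw) (T + k) (δ / 3) ‖(x₀ : E n)‖₊
  set y := 1 + 16 * sumZBar G n σw (T + k) (δ / 3) ‖(x₀ : E n)‖₊ / (c * p * (((T + k : ℕ) : ℝ) - 1))
    with hy
  have hy0 : 0 < y := by positivity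
  have hk : ((T + k : ℕ) : ℝ) - T + 1 = k + 1 := by push_cast; ring
  rw [hk] at this
  have h1 : d * Real.log y + Real.log (Real.pi ^ 2 * ((k : ℝ) + 1) ^ 2 / (2 * δ)) ≤
      (1 - Real.log 2) * p * (((T + k : ℕ) : ℝ) - 1) / 2 := by
    have h2 : 2 / ((1 - Real.log 2) * p) *
        (d * Real.log y + Real.log (Real.pi ^ 2 * ((k : ℝ) + 1) ^ 2 / (2 * δ))) ≤
        ((T + k : ℕ) : ℝ) - 1 := by linarith
    rw [div_mul_eq_mul_div, div_le_iff₀ (by positivity)] at h2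
    linarith
  have e1 : y ^ d = Real.exp (d * Real.log y) := by
    rw [← Real.log_pow, Real.exp_log (by positivity)]
  -- The weight 2δ/(π²(k+1)²) is the reciprocal of the argument of the second logarithm in the
  -- burn-in condition.
  have e2 : 6 * (δ / 3) / (Real.pi ^ 2 * ((k : ℝ) + 1) ^ 2) =
      Real.exp (-Real.log (Real.pi ^ 2 * ((k : ℝ) + 1) ^ 2 / (2 * δ))) := by
    rw [Real.exp_neg, Real.exp_log (by positivity), inv_div]
    congr 1
    ring
  rw [e1, e2, ← Real.exp_add, Real.exp_le_exp]
  linarith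

theorem reach_mono {A B : Set (E n)} (h : A ⊆ B) : reach M G A ⊆ reach M G B := by
  rintro _ ⟨x, u, hx, hu, rfl⟩
  exact ⟨x, u, h hx, hu, rfl⟩

/-- As t - 1 lies strictly below the supremum, some admissible T ≥ t exists; the inclusion descends
to t because the balls are nested. This also covers an infinite supremum. -/
theorem reach_subset_of_le_tExcited {XPE : Set (E n)} {x₀ : M.X}
    (hx : Monotone fun t => xBar G n σw t (δ / 3) ‖(x₀ : E n)‖₊) {t : ℕ} (ht : 1 ≤ t)
    (h : (t : ℕ∞) ≤ tExcited M G σw XPE δ x₀) :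
    reach M G (Metric.closedBall 0 (xBar G n σw (t - 1) (δ / 3) ‖(x₀ : E n)‖₊) ∩ M.X) ⊆ XPE := by
  have hlt : ((t - 1 : ℕ) : ℕ∞) < tExcited M G σw XPE δ x₀ :=
    lt_of_lt_of_le (by exact_mod_cast (by omega : t - 1 < t)) h
  simp only [tExcited, lt_iSup_iff] at hlt
  obtain ⟨T, ⟨-, hT⟩, hlt⟩ := hlt
  have hlt' : t - 1 < T := by exact_mod_cast hlt
  refine (reach_mono ?_).trans hT
  refine Set.inter_subset_inter_left _ (Metric.closedBall_subset_closedBall ?_)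
  exact_mod_cast hx (show t - 1 ≤ T - 1 by omega)

end BurnIn

/-! ### Bounds along trajectories with bounded noise -/

section Trajectory

variable {n m d q : ℕ} {M : Model n m d q} {G : Growth} {σw : ℝ≥0} {δ : ℝ}

/-- The state bound concerns arbitrary controls; the closed loop is the solution driven by its own.
-/
theorem Model.traj_fst_eq_solution (x₀ : M.X) (w : ℕ → M.W) (s : ℕ → M.S) (t : ℕ) :
    (M.traj x₀ w s t).1 = M.solution x₀ (fun i => (M.traj x₀ w s i).2) w t := by
  induction t with
  | zero => rfl
  | succ t ih =>
    rw [solution, ← ih]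
    exact Subtype.ext (M.traj_succ_fst x₀ w s t)

theorem ConstrainedControls.traj_le (hu : ConstrainedControls M G) (x₀ : M.X) (w : ℕ → M.W)
    (s : ℕ → M.S) (t : ℕ) : ‖((M.traj x₀ w s t).2 : E m)‖₊ ≤ G.uMax := by
  rw [M.traj_snd]
  exact hu _ _ _

theorem StateBound.traj_le (hS : StateBound M G) (hu : ConstrainedControls M G) (hn : 0 < n)
    (hδ : 0 < δ) (x₀ : M.X) (w : ℕ → M.W) (s : ℕ → M.S)
    (hw : ∀ t, ‖(w (t + 1) : E n)‖₊ ≤ wBar n σw (t + 1) δ) (t : ℕ) :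
    ‖((M.traj x₀ w s t).1 : E n)‖₊ ≤ xBar G n σw t δ ‖(x₀ : E n)‖₊ := by
  rw [Model.traj_fst_eq_solution]
  refine (hS.bound t x₀ _ w).trans ?_
  unfold xBar
  gcongr
  · refine hS.χ₃.1.strictMono.monotone ?_
    calc _ ≤ ∑ _i ∈ Finset.range t, G.σ₁ G.uMax := Finset.sum_le_sum fun i _ =>
          hS.σ₁.strictMono.monotone (hu.traj_le x₀ w s i)
      _ = _ := by simp
  · refine hS.χ₄.1.strictMono.monotone ?_
    calc _ ≤ ∑ _i ∈ Finset.Icc 1 t, G.σ₂ (wBar n σw t δ) := by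
          refine Finset.sum_le_sum fun i hi => hS.σ₂.1.strictMono.monotone ?_
          obtain ⟨h1, h2⟩ := Finset.mem_Icc.1 hi
          have := hw (i - 1)
          rw [Nat.sub_add_cancel h1] at this
          exact this.trans (wBar_mono hn hδ h2)
      _ = _ := by simp

theorem sum_norm_sq_le_sumZBar (hS : StateBound M G) (hu : ConstrainedControls M G)
    (hb : BasisBound M G) (hn : 0 < n) (hδ : 0 < δ) (x₀ : M.X) (w : ℕ → M.W) (s : ℕ → M.S)
    (hw : ∀ t, ‖(w (t + 1) : E n)‖₊ ≤ wBar n σw (t + 1) δ) (t : ℕ) :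
    ∑ i ∈ Finset.range t, ‖M.ψ (M.traj x₀ w s i)‖ ^ 2 ≤ sumZBar G n σw t δ ‖(x₀ : E n)‖₊ := by
  have e : sumZBar G n σw t δ ‖(x₀ : E n)‖₊ =
      ∑ i ∈ Finset.range t, (zBar G n σw (i + 1) δ ‖(x₀ : E n)‖₊ : ℝ) ^ 2 := by
    rw [sumZBar, Finset.range_eq_Ico, Finset.sum_Ico_add' (fun i =>
      (zBar G n σw i δ ‖(x₀ : E n)‖₊ : ℝ) ^ 2) 0 t 1]
    rfl
  rw [e]
  refine Finset.sum_le_sum fun i _ => ?_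
  have h1 : ‖M.ψ (M.traj x₀ w s i)‖₊ ≤ zBar G n σw (i + 1) δ ‖(x₀ : E n)‖₊ := by
    refine (hb.bound _ _).trans (hb.mono (NNReal.sqrt_le_sqrt.2 ?_))
    have h2 := hS.traj_le hu hn hδ x₀ w s hw i
    have h3 := hu.traj_le x₀ w s i
    rw [Nat.add_sub_cancel]
    gcongr <;> assumption
  have h2 : ‖M.ψ (M.traj x₀ w s i)‖ ≤ zBar G n σw (i + 1) δ ‖(x₀ : E n)‖₊ := by exact_mod_cast h1
  gcongr

theorem Model.residual_traj (x₀ : M.X) (w : ℕ → M.W) (s : ℕ → M.S) (t : ℕ) :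
    M.residual (M.traj x₀ w s) t = (w (t + 1) : E n).ofLp := by
  rw [residual, M.traj_succ_fst, predict]
  simp

end Trajectory

/-! ### The estimation error -/

section Error

variable {n m d q : ℕ} {M : Model n m d q} {G : Growth} {σw : ℝ≥0} {c p δ : ℝ}

theorem sum_dotProduct_regressor_sq (h : ℕ → M.X × M.U) (t : ℕ) (x : Fin d → ℝ) :
    ∑ s ∈ Finset.range t, (x ⬝ᵥ M.regressor h s) ^ 2 =
      ∑ s ∈ Finset.range t, ⟪(WithLp.toLp 2 x : E d), M.ψ (h s)⟫ ^ 2 := by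
  refine Finset.sum_congr rfl fun s _ => ?_
  rw [EuclideanSpace.inner_eq_star_dotProduct, star_trivial, dotProduct_comm]
  rfl

theorem dotProduct_self_eq_norm_sq (x : Fin d → ℝ) :
    x ⬝ᵥ x = ‖(WithLp.toLp 2 x : E d)‖ ^ 2 := by
  rw [EuclideanSpace.real_norm_sq_eq]
  simp only [dotProduct, sq]

/-- Homogeneity extends the energy bound from unit vectors to all vectors; regularisation adds γ. -/
theorem le_dotProduct_gram_mulVec {h : ℕ → M.X × M.U} {t : ℕ} {κ : ℝ}
    (hκ : ∀ ζ : E d, ‖ζ‖ = 1 → κ ≤ ∑ i ∈ Finset.range t, ⟪ζ, M.ψ (h i)⟫ ^ 2) (x : Fin d → ℝ) :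
    (κ + M.γ) * (x ⬝ᵥ x) ≤ x ⬝ᵥ (M.gram h t).mulVec x := by
  rw [M.dotProduct_gram_mulVec, sum_dotProduct_regressor_sq, dotProduct_self_eq_norm_sq, add_mul,
    add_comm]
  gcongr
  set v : E d := WithLp.toLp 2 x
  rcases eq_or_ne v 0 with hv | hv
  · simp [hv]
  · have hv' : 0 < ‖v‖ := norm_pos_iff.2 hv
    have h1 := hκ (‖v‖⁻¹ • v) (by rw [norm_smul, norm_inv, norm_norm, inv_mul_cancel₀ hv'.ne'])
    simp only [inner_smul_left, mul_pow, ← Finset.mul_sum, conj_trivial] at h1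
    calc κ * ‖v‖ ^ 2 ≤ ‖v‖⁻¹ ^ 2 * (∑ i ∈ Finset.range t, ⟪v, M.ψ (h i)⟫ ^ 2) * ‖v‖ ^ 2 := by gcongr
      _ = _ := by field_simp

theorem det_gram_div_le {h : ℕ → M.X × M.U} {t : ℕ} {Z : ℝ}
    (hZ : ∑ i ∈ Finset.range t, ‖M.ψ (h i)‖ ^ 2 ≤ Z) :
    (M.gram h t).det / M.γ ^ d ≤ ((Z + M.γ) * M.γ⁻¹) ^ d := by
  have hγ := M.γ_pos
  rw [← div_eq_mul_inv, div_pow]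
  gcongr
  refine det_le_pow (M.gram_posDef h t) fun x => ?_
  rw [M.dotProduct_gram_mulVec, sum_dotProduct_regressor_sq, dotProduct_self_eq_norm_sq, add_mul,
    add_comm]
  gcongr
  calc _ ≤ ∑ i ∈ Finset.range t, ‖M.ψ (h i)‖ ^ 2 * ‖(WithLp.toLp 2 x : E d)‖ ^ 2 := by
        refine Finset.sum_le_sum fun i _ => ?_
        rw [← sq_abs, ← mul_pow, mul_comm]
        gcongr
        exact abs_real_inner_le_norm _ _
    _ = (∑ i ∈ Finset.range t, ‖M.ψ (h i)‖ ^ 2) * ‖(WithLp.toLp 2 x : E d)‖ ^ 2 := by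
        rw [Finset.sum_mul]
    _ ≤ _ := by gcongr

theorem selfNorm_eq_zero {h : ℕ → M.X × M.U} (hr : ∀ s, M.residual h s = 0) (j : Fin n) (t : ℕ) :
    M.selfNorm j t h = 0 := by
  have : M.noiseSum h t = 0 :=
    Finset.sum_eq_zero fun s _ => by
      rw [hr]
      ext
      simp [Matrix.vecMulVec_apply]
  have h0 : (M.noiseSum h t).col j = 0 := by ext; simp [this, Matrix.col]
  simp [Model.selfNorm, h0]

/-- The error bound holds wherever the noise, self-normalisation and excitation bounds hold. -/
theorem specNorm_estimate_sub_le (hn : 0 < n) (hc : 0 < c) (hp : 0 < p)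
    (hδ : δ ∈ Set.Ioo (0 : ℝ) 1) (x₀ : M.X) (w : ℕ → M.W) (s : ℕ → M.S) {t : ℕ} (ht : 1 ≤ t)
    (hw : ∀ t, ‖(w (t + 1) : E n)‖₊ ≤ wBar n σw (t + 1) (δ / 3))
    (hZ : ∑ i ∈ Finset.range t, ‖M.ψ (M.traj x₀ w s i)‖ ^ 2 ≤ sumZBar G n σw t (δ / 3) ‖(x₀ : E n)‖₊)
    (hself : σw ≠ 0 → ∀ j, M.selfNorm j t (M.traj x₀ w s) ≤
      2 * (σw : ℝ) ^ 2 * (Real.log (1 / (δ / (3 * n)))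
        + 1 / 2 * Real.log ((M.gram (M.traj x₀ w s) t).det / M.γ ^ d)))
    (hexc : ∀ ζ : E d, ‖ζ‖ = 1 → c * p / 4 * ((t : ℝ) - 1) ≤
      ∑ i ∈ Finset.range t, ⟪ζ, M.ψ (M.traj x₀ w s i)⟫ ^ 2) :
    specNorm (M.estimate x₀ w s t - M.θ) ≤ errBound M G σw c p t δ x₀ := by
  have hγ := M.γ_pos
  have hδ0 := hδ.1
  have hn1 : (1 : ℝ) ≤ n := by exact_mod_cast hn
  have ht1 : (0 : ℝ) ≤ (t : ℝ) - 1 := by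
    have : (1 : ℝ) ≤ t := by exact_mod_cast ht
    linarith
  set h := M.traj x₀ w s with hh
  set β := betaMax M G σw t (δ / 3) x₀ with hβ
  have hZ0 := sumZBar_nonneg (G := G) (n := n) (σw := σw) t (δ / 3) ‖(x₀ : E n)‖₊
  have hβ1 : 1 ≤ β * M.γ⁻¹ := by
    rw [← div_eq_mul_inv, le_div_iff₀ hγ, one_mul, hβ, betaMax]
    linarith
  set L := Real.log (3 * n / δ) + (d : ℝ) / 2 * Real.log (β * M.γ⁻¹) with hL
  have hL0 : 0 ≤ L := by
    refine add_nonneg (Real.log_nonneg ?_) (mul_nonneg (by positivity) (Real.log_nonneg hβ1))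
    rw [le_div_iff₀ hδ0]
    linarith [hδ.2]
  have hdet : 0 < (M.gram h t).det / M.γ ^ d :=
    div_pos (M.gram_posDef h t).det_pos (pow_pos hγ d)
  have hB : ∀ j, M.selfNorm j t h ≤ 2 * (σw : ℝ) ^ 2 * L := by
    intro j
    by_cases hσ : σw = 0
    -- For σ = 0 the noise bound is zero, so the noise vanishes on this trajectory and no
    -- self-normalised inequality is needed.
    · have hr : ∀ s, M.residual h s = 0 := by
        intro i
        have hwi := hw i
        rw [hσ, wBar, if_neg (Nat.succ_ne_zero i), zero_mul] at hwi
        have : (w (i + 1) : E n) = 0 := nnnorm_eq_zero.1 (le_antisymm hwi zero_le)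
        rw [hh, Model.residual_traj, this]
        rfl
      rw [selfNorm_eq_zero hr, hσ]
      simp
    · refine (hself hσ j).trans ?_
      have h1 : Real.log ((M.gram h t).det / M.γ ^ d) ≤ d * Real.log (β * M.γ⁻¹) := by
        rw [← Real.log_pow]
        exact Real.log_le_log hdet (det_gram_div_le hZ)
      have h2 : (1 : ℝ) / (δ / (3 * n)) = 3 * n / δ := one_div_div _ _
      rw [h2, hL]
      exact mul_le_mul_of_nonneg_left (add_le_add le_rfl (by linarith)) (by positivity)
  -- The Gramian bound is used at κ = 0, for the bias term, and at the excitation level, for the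
  -- denominator.
  have key := specNorm_le_of_mul_eq (M.gram_posDef h t) (l := c * p / 4 * ((t : ℝ) - 1) + M.γ) hγ
    (by positivity) (by positivity : 0 ≤ 2 * (σw : ℝ) ^ 2 * L)
    (fun x => by
      have := le_dotProduct_gram_mulVec (h := h) (t := t) (κ := 0)
        (fun ζ _ => Finset.sum_nonneg fun _ _ => sq_nonneg _) x
      rwa [zero_add] at this)
    (le_dotProduct_gram_mulVec hexc) (M.gram_mul_rls_sub h (by omega : t ≠ 0)) hB
  have e : √(n * (2 * (σw : ℝ) ^ 2 * L)) = σw * √(2 * n * L) := by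
    rw [show n * (2 * (σw : ℝ) ^ 2 * L) = (σw : ℝ) ^ 2 * (2 * n * L) by ring,
      Real.sqrt_mul (sq_nonneg _), Real.sqrt_sq (NNReal.coe_nonneg _)]
  rw [e] at key
  exact key

end Error

end SysId

end

/-! ### The main theorem: union bound over the three failure events -/

theorem theorem1 {n m d q : ℕ} (hn : 0 < n) (hd : 0 < d) (M : SysId.Model n m d q)
    {Ω : Type*} [MeasurableSpace Ω] (P : Measure Ω) [IsProbabilityMeasure P]
    (W : ℕ → Ω → M.W) (S : ℕ → Ω → M.S)
    (μw : Measure M.W) (μs : Measure M.S) (σw : ℝ≥0)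
    (G : SysId.Growth) (XPE : Set (SysId.E n)) (c p : ℝ)
    (hmeas : SysId.MeasurableMaps M)
    (hnoise : SysId.NoiseAssumption M P W S μw μs σw)
    (hstate : SysId.StateBound M G)
    (hcontrol : SysId.ConstrainedControls M G)
    (hbasis : SysId.BasisBound M G)
    (hexc : SysId.RegionallyExcited M μs μw XPE c p)
    (δ : ℝ) (hδ : δ ∈ Set.Ioo (0 : ℝ) 1) (x₀ : M.X) :
    SysId.tBurnIn M G σw c p δ x₀ < ⊤ ∧
    (SysId.tBurnIn M G σw c p δ x₀ ≤ SysId.tExcited M G σw XPE δ x₀ →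
      ENNReal.ofReal (1 - δ) ≤
        P {ω | ∀ t : ℕ, SysId.tBurnIn M G σw c p δ x₀ ≤ t →
          (t : ℕ∞) ≤ SysId.tExcited M G σw XPE δ x₀ →
          SysId.specNorm (M.estimate x₀ (fun i => W i ω) (fun i => S i ω) t - M.θ)
            ≤ SysId.errBound M G σw c p t δ x₀}) := by
  classical
  open SysId in
  have hδ0 := hδ.1
  have hη : δ / 3 ∈ Set.Ioo (0 : ℝ) 1 := ⟨by positivity, by linarith [hδ.2]⟩
  have hη0 := hη.1
  have hc := hexc.c_pos
  have hp := hexc.p_pos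
  have h1m := hstate.χ₁.1.strictMono.monotone
  have h3m := hstate.χ₃.1.strictMono.monotone
  have h4m := hstate.χ₄.1.strictMono.monotone
  have hs2m := hstate.σ₂.1.strictMono.monotone
  have hxm := xBar_mono (G := G) (n := n) (σw := σw) h1m h3m h4m hs2m hn hη0 ‖(x₀ : E n)‖₊
  have hxs := subExpSeq_xBar (G := G) (n := n) (σw := σw) hstate.χ₁.2 hstate.χ₃.2 h3m hstate.χ₄.2
    h4m hstate.σ₂.2 hs2m hη0 ‖(x₀ : E n)‖₊
  have hZs := subExpSeq_sumZBar hxs hxm hbasis.mono hbasis.apb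
  obtain ⟨T, hTeq, hT1, hT⟩ := tBurnIn_eq x₀ (exists_burnedIn hc hp hδ0 x₀ hZs)
  have hT2 := hT.two_le hp hδ hT1
  rw [hTeq]
  refine ⟨ENat.natCast_lt_top T, fun _ => ?_⟩
  let h : Ω → ℕ → M.X × M.U := fun ω => M.traj x₀ (fun i => W i ω) (fun i => S i ω)
  let A : Set Ω := {ω | ∃ t, wBar n σw (t + 1) (δ / 3) < ‖(W (t + 1) ω : E n)‖₊}
  let B : Fin n → Set Ω := fun j => {ω | σw ≠ 0 ∧ ∃ t, 2 * (σw : ℝ) ^ 2 *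
    (Real.log (1 / (δ / (3 * n))) + 1 / 2 * Real.log ((M.gram (h ω) t).det / M.γ ^ d))
      < M.selfNorm j t (h ω)}
  -- Times past the excited bound contribute the empty set, so the union over all k can be bounded
  -- by the full series. The common radius x̄(t-1) serves all earlier times by monotonicity.
  let C : ℕ → Set Ω := fun k => {ω | ((T + k : ℕ) : ℕ∞) ≤ tExcited M G σw XPE δ x₀ ∧
    (∀ i < T + k, M.Bounded (xBar G n σw (T + k - 1) (δ / 3) ‖(x₀ : E n)‖₊) G.uMax (h ω) i) ∧
    ∑ i ∈ Finset.range (T + k), ‖M.ψ (h ω i)‖ ^ 2 ≤ sumZBar G n σw (T + k) (δ / 3) ‖(x₀ : E n)‖₊ ∧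
    ∃ ζ : E d, ‖ζ‖ = 1 ∧ ∑ i ∈ Finset.range (T + k), ⟪ζ, M.ψ (h ω i)⟫ ^ 2
      < c * p / 4 * (((T + k : ℕ) : ℝ) - 1)}
  have hA : P A ≤ ENNReal.ofReal (δ / 3) := hnoise.measure_exists_norm_gt_wBar hn hη
  have hB : P (⋃ j, B j) ≤ ENNReal.ofReal (δ / 3) := by
    have hn' : (0 : ℝ) < n := by exact_mod_cast hn
    -- Each of the n columns receives an equal share of δ/3.
    have hBj : ∀ j, P (B j) ≤ ENNReal.ofReal (δ / (3 * n)) := by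
      intro j
      by_cases hσ : σw = 0
      · simp [B, hσ]
      · refine (measure_mono fun ω hω => hω.2).trans
          (hnoise.measure_selfNorm_gt hmeas hσ x₀ j (η := δ / (3 * n)) (by positivity))
    calc P (⋃ j, B j) ≤ ∑ j, P (B j) := measure_iUnion_fintype_le _ _
      _ ≤ ∑ _j : Fin n, ENNReal.ofReal (δ / (3 * n)) := Finset.sum_le_sum fun j _ => hBj j
      _ = ENNReal.ofReal (n * (δ / (3 * n))) := by
        rw [Finset.sum_const, Finset.card_univ, Fintype.card_fin, nsmul_eq_mul,
          ENNReal.ofReal_mul hn'.le, ENNReal.ofReal_natCast]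
      _ = ENNReal.ofReal (δ / 3) := by congr 1; field_simp
  have hC : P (⋃ k, C k) ≤ ENNReal.ofReal (δ / 3) := by
    rw [← tsum_ofReal_inv_sq hη0.le]
    refine (measure_iUnion_le _).trans (ENNReal.tsum_le_tsum fun k => ?_)
    by_cases hk : ((T + k : ℕ) : ℕ∞) ≤ tExcited M G σw XPE δ x₀
    · have hR := reach_subset_of_le_tExcited hxm (by omega : 1 ≤ T + k) hk
      refine (measure_mono fun ω hω => hω.2).trans ((hexc.measure_exists_energy_lt hd hmeas hnoise hR
        x₀ (by omega : 2 ≤ T + k) (sumZBar_nonneg (T + k) (δ / 3) ‖(x₀ : E n)‖₊)).trans ?_)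
      exact ENNReal.ofReal_le_ofReal (hT.mul_exp_le hc hp hδ0 hT2 k)
    · have : C k = ∅ := Set.eq_empty_of_forall_notMem fun ω hω => hk hω.1
      rw [this, measure_empty]
      exact zero_le
  set Good : Set Ω := {ω | ∀ t : ℕ, ((T : ℕ) : ℕ∞) ≤ t →
          (t : ℕ∞) ≤ SysId.tExcited M G σw XPE δ x₀ →
          SysId.specNorm (M.estimate x₀ (fun i => W i ω) (fun i => S i ω) t - M.θ)
            ≤ SysId.errBound M G σw c p t δ x₀} with hGood
  have hcover : Goodᶜ ⊆ A ∪ ((⋃ j, B j) ∪ ⋃ k, C k) := by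
    intro ω hω
    by_contra hcon
    simp only [Set.mem_union, Set.mem_iUnion, not_or, not_exists] at hcon
    obtain ⟨hωA, hωB, hωC⟩ := hcon
    refine hω fun t hTt htE => ?_
    have hTt' : T ≤ t := by exact_mod_cast hTt
    obtain ⟨k, rfl⟩ := Nat.exists_eq_add_of_le hTt'
    have hw : ∀ t, ‖(W (t + 1) ω : E n)‖₊ ≤ wBar n σw (t + 1) (δ / 3) := by
      intro t
      by_contra hlt
      exact hωA ⟨t, not_le.1 hlt⟩
    have hZ := sum_norm_sq_le_sumZBar hstate hcontrol hbasis hn hη0 x₀ (fun i => W i ω)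
      (fun i => S i ω) hw (T + k)
    refine specNorm_estimate_sub_le hn hc hp hδ x₀ _ _ (by omega) hw hZ ?_ ?_
    · intro hσ j
      by_contra hlt
      exact hωB j ⟨hσ, T + k, not_le.1 hlt⟩
    · intro ζ hζ
      by_contra hlt
      refine hωC k ⟨htE, fun i hi => ⟨?_, hcontrol.traj_le x₀ _ _ i⟩, hZ, ζ, hζ, not_le.1 hlt⟩
      have hi' : i ≤ T + k - 1 := by omega
      have h1 := hstate.traj_le hcontrol hn hη0 x₀ (fun i => W i ω) (fun i => S i ω) hw i
      have h2 := hxm hi'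
      exact h1.trans h2
  have hbad : P Goodᶜ ≤ ENNReal.ofReal δ := by
    calc P Goodᶜ ≤ P A + (P (⋃ j, B j) + P (⋃ k, C k)) :=
          (measure_mono hcover).trans ((measure_union_le _ _).trans
            (add_le_add le_rfl (measure_union_le _ _)))
      _ ≤ ENNReal.ofReal (δ / 3) + (ENNReal.ofReal (δ / 3) + ENNReal.ofReal (δ / 3)) := by gcongr
      _ = ENNReal.ofReal δ := by
        rw [← ENNReal.ofReal_add hη0.le hη0.le, ← ENNReal.ofReal_add hη0.le (by positivity)]
        congr 1
        ring
  -- Subadditivity suffices here, so measurability of `Good` is not required.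
  have htot : (1 : ℝ≥0∞) ≤ P Good + P Goodᶜ := by
    rw [← measure_univ (μ := P), ← Set.union_compl_self Good]
    exact measure_union_le _ _
  rw [ENNReal.ofReal_sub _ hδ0.le, ENNReal.ofReal_one, tsub_le_iff_right]
  exact htot.trans (by gcongr)
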